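/- Conventions. Quaternions are complexified quaternions $q=s+x\mathbf i+y\mathbf j+z\mathbf k$ ($s,x,y,z\in\mathbb C$), with conjugate $q^*=s-x\mathbf i-y\mathbf j-z\mathbf k$; real quaternions are those with $s,x,y,z\in\mathbb R$. For a quaternion matrix $X=(X_{ij})_{1\le i,j\le m}$ the Moore–Dyson determinant is $$\mathrm{Det}_M(X)=\sum_{\sigma\in S_m}\varepsilon(\sigma)\,(X_{n_1i_2}X_{i_2i_3}\cdots X_{i_sn_1})\cdots(X_{n_rk_2}X_{k_2k_3}\cdots X_{k_ln_r}),$$ where $\sigma=(n_1i_2\ldots i_s)\cdots(n_rk_2\ldots k_l)$ is written as a product of cycles, each starting with its largest element, and $n_1>\dots>n_r$. Let $\mu$ be a $\sigma$-finite measure on $\Lambda$. A random point field on $\Lambda$ is a probability measure on the locally finite countable configurations of points of $\Lambda$ (with multiplicity). A locally integrable function $R_k:\Lambda^k\to[0,\infty)$ is its $k$-point correlation function if $$\mathbb E\prod_{i}\#(A_i)\cdots(\#(A_i)-k_i+1)=\int_{A_1^{k_1}\times\cdots\times A_n^{k_n}}R_k\,d\mu^{\otimes k}$$ for all disjoint measurable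 $A_1,\dots,A_n$ and all integers $k_i\ge 0$ with $\sum_i k_i=k$. The field is Pfaffian with the self-dual kernel $K$ (that is, $K(y,x)=K(x,y)^*$) if for every $m\ge1$ it has an $m$-point correlation function $R_m$, and $R_m(x_1,\dots,x_m)=\mathrm{Det}_M(K(x_i,x_j))_{1\le i,j\le m}$ almost everywhere. Theorem. Let $K$ be a self-dual quaternion kernel on $\Lambda$ with a real diagonal form $$K(x,y)=\sum_{k}\lambda_k\,u_k(x)\,u_k^*(y),$$ where the sum is finite or countable, $(u_k)$ is a system of real quaternion functions that is orthonormal, $\int_\Lambda u_k^*u_l\,d\mu=\delta_{kl}$, the $\lambda_k$ are real, and the series converges absolutely almost everywhere. Assume that all $\lambda_k\in[0,1]$ and that $\sum_k\lambda_k<\infty$. Let $\xi_k$ be independent random variables with $\mathbb P(\xi_k=1)=\lambda_k$ and $\mathbb P(\xi_k=0)=1-\lambda_k$, and let $$K_\xi(x,y)=\sum_k\xi_k\,u_k(x)\,u_k^*(y).$$ Then: (1) A mix $\mathcal X_\xi$ of Pfaffian point fields with the random kernels $K_\xi$ exists: there are random point fields depending measurably on the randomness of $\xi$ which are almost surely Pfaffian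 with kernel $K_\xi$, and $\mathcal X_\xi$ is distributed according to the average of their laws. (2) Every such mix $\mathcal X_\xi$ is a Pfaffian point field with kernel $K$. (3) For every $m$ and almost every $(x_1,\dots,x_m)\in\Lambda^m$, the random variable $\mathrm{Det}_M(K_\xi(x_i,x_j))$ is integrable and $$\mathbb E\,\mathrm{Det}_M\bigl(K_\xi(x_i,x_j)\bigr)_{1\le i,j\le m}=\mathrm{Det}_M\bigl(K(x_i,x_j)\bigr)_{1\le i,j\le m}.$$ -/

import Mathlib

open MeasureTheory ProbabilityTheory
open scoped Quaternion ENNReal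

noncomputable section

namespace PfaffianField

/-! ### The Moore-Dyson determinant -/

/-- The leaders of the cycles of `σ` (fixed points are cycles of length one): the largest elements
of the cycles, listed in decreasing order. -/
def cycleLeaders {n : ℕ} (σ : Equiv.Perm (Fin n)) : List (Fin n) :=
  (List.finRange n).reverse.filter fun i => ∀ j, σ.SameCycle i j → j ≤ i

/-- The ordered product `X_{i i₂} X_{i₂ i₃} ⋯ X_{i_s i}` along the cycle
`(i i₂ … i_s) = (i, σ i, σ² i, …)` of `σ`. -/
def cycleProd {A : Type*} [Ring A] {n : ℕ} (X : Matrix (Fin n) (Fin n) A)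
    (σ : Equiv.Perm (Fin n)) (i : Fin n) : A :=
  ((List.range (Function.minimalPeriod σ i)).map
    fun s => X ((σ ^ s) i) ((σ ^ (s + 1)) i)).prod

/-- The Moore-Dyson determinant of a square matrix with entries in a (noncommutative) ring. -/
def mooreDet {A : Type*} [Ring A] {n : ℕ} (X : Matrix (Fin n) (Fin n) A) : A :=
  ∑ σ : Equiv.Perm (Fin n),
    (Equiv.Perm.sign σ : ℤ) • ((cycleLeaders σ).map (cycleProd X σ)).prod

/-- The inclusion of the real quaternions into the complexified quaternions `ℍ[ℂ]`. On `ℍ[ℂ]`,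
`star` is the quaternion conjugation `s + xi + yj + zk ↦ s - xi - yj - zk`; it does not conjugate
the complex coefficients. -/
def complexify (q : ℍ[ℝ]) : ℍ[ℂ] := ⟨q.re, q.imI, q.imJ, q.imK⟩

/-- `K(y, x) = K(x, y)^*`. -/
def IsSelfDualKernel {Λ : Type*} (K : Λ → Λ → ℍ[ℂ]) : Prop :=
  ∀ x y, K y x = star (K x y)

/-! ### Random point fields and correlation functions -/

/-- Locally finite configurations of points of `Λ` (counted with multiplicity), encoded by their
counting measures: countable sums of unit masses which are finite on compact sets. The number of
points in `A` is the mass of `A`. The σ-algebra is the one generated by the numbers of points in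
measurable sets. -/
abbrev Configuration (Λ : Type*) [TopologicalSpace Λ] [MeasurableSpace Λ] : Type _ :=
  {ν : Measure Λ //
    (∃ (s : Set ℕ) (p : s → Λ), ν = Measure.sum fun i => Measure.dirac (p i)) ∧
      ∀ C : Set Λ, IsCompact C → ν C < ∞}

/-- `N (N - 1) ⋯ (N - k + 1)` for a number of points `N`. -/
def fallingFactorial (N : ℝ≥0∞) (k : ℕ) : ℝ≥0∞ := ∏ j ∈ Finset.range k, (N - j)

/-- The block product `A₁^{k₁} × ⋯ × A_m^{k_m}` in `Λ^k`, where `k = k₁ + ⋯ + k_m`. -/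
def blockProd {Λ : Type*} {m k : ℕ} (A : Fin m → Set Λ) (κ : Fin m → ℕ) (h : ∑ i, κ i = k) :
    Set (Fin k → Λ) :=
  {x | ∀ (i : Fin m) (j : Fin (κ i)), x (Fin.cast h (finSigmaFinEquiv ⟨i, j⟩)) ∈ A i}

/-- `R` is a `k`-point correlation function, with respect to `μ`, of the random point field with
law `P`. -/
structure IsCorrelationFunction {Λ : Type*} [TopologicalSpace Λ] [MeasurableSpace Λ]
    (μ : Measure Λ) [SigmaFinite μ] (P : Measure (Configuration Λ)) (k : ℕ)
    (R : (Fin k → Λ) → ℝ) : Prop where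
  nonneg : ∀ x, 0 ≤ R x
  locallyIntegrable : LocallyIntegrable R (Measure.pi fun _ => μ)
  moment : ∀ (m : ℕ) (A : Fin m → Set Λ) (κ : Fin m → ℕ) (h : ∑ i, κ i = k),
    (∀ i, MeasurableSet (A i)) → Pairwise (fun i j => Disjoint (A i) (A j)) →
      ∫⁻ ν, ∏ i, fallingFactorial (ν.1 (A i)) (κ i) ∂P =
        ∫⁻ x in blockProd A κ h, ENNReal.ofReal (R x) ∂(Measure.pi fun _ => μ)

/-- `P` is the law of a Pfaffian random point field with kernel `K`: it has correlation functions
of all orders and `R_m(x₁, …, x_m) = Det_M (K(x_i, x_j))` (correlation functions are only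
determined up to null sets). -/
structure IsPfaffianPointField {Λ : Type*} [TopologicalSpace Λ] [MeasurableSpace Λ]
    (μ : Measure Λ) [SigmaFinite μ] (P : Measure (Configuration Λ)) (K : Λ → Λ → ℍ[ℂ]) :
    Prop where
  isProbabilityMeasure : IsProbabilityMeasure P
  selfDual : IsSelfDualKernel K
  correlation : ∀ m : ℕ, 1 ≤ m → ∃ R : (Fin m → Λ) → ℝ,
    IsCorrelationFunction μ P m R ∧
      ∀ᵐ x ∂(Measure.pi fun _ : Fin m => μ),
        complexify ((R x : ℝ) : ℍ[ℝ]) = mooreDet (Matrix.of fun i j => K (x i) (x j))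

/-- `Q` is the law of a mix of Pfaffian point fields with random kernel `K ω`: for almost every
`ω`, the conditional law `P ω` is that of a Pfaffian point field with kernel `K ω`, and `Q` is the
average of the laws `P ω`. -/
def IsPfaffianMixture {Λ Ω : Type*} [TopologicalSpace Λ] [MeasurableSpace Λ] [MeasurableSpace Ω]
    (μ : Measure Λ) [SigmaFinite μ] (ρ : Measure Ω) (K : Ω → Λ → Λ → ℍ[ℂ])
    (Q : Measure (Configuration Λ)) : Prop :=
  ∃ P : Kernel Ω (Configuration Λ), IsMarkovKernel P ∧
    (∀ᵐ ω ∂ρ, IsPfaffianPointField μ (P ω) (K ω)) ∧ Q = ρ.bind P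

/-! ### Kernels in real diagonal form -/

/-- The sum of the series `∑ₖ cₖ uₖ(x) uₖ(y)^*`. -/
def diagSeries {Λ ι : Type*} (c : ι → ℝ) (u : ι → Λ → ℍ[ℝ]) (x y : Λ) : ℍ[ℝ] :=
  ∑' k, c k • (u k x * star (u k y))

/-- `K` has a real diagonal form with eigenvalues `lam k` and eigenfunctions `u k`: the `u k` are
an orthonormal system of real quaternion functions, the series `∑ₖ lam k • u k x * (u k y)^*` is
absolutely convergent almost everywhere, and `K` is its sum wherever it converges absolutely. -/
structure HasRealDiagonalForm {Λ ι : Type*} [MeasurableSpace Λ] (μ : Measure Λ)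
    (K : Λ → Λ → ℍ[ℂ]) (lam : ι → ℝ) (u : ι → Λ → ℍ[ℝ]) : Prop where
  memLp : ∀ k, MemLp (u k) 2 μ
  normalized : ∀ k, ∫ x, star (u k x) * u k x ∂μ = 1
  orthogonal : ∀ k l, k ≠ l → ∫ x, star (u k x) * u l x ∂μ = 0
  summable : ∀ᵐ p ∂(μ.prod μ), Summable fun k => ‖lam k • (u k p.1 * star (u k p.2))‖
  eq_series : ∀ x y, (Summable fun k => ‖lam k • (u k x * star (u k y))‖) →
    K x y = complexify (diagSeries lam u x y)

/-- The random variables `ξ k` are independent, and `ξ k` takes the value `1` with probability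
`lam k` and the value `0` with probability `1 - lam k`. -/
structure IsIndepBernoulli {Ω ι : Type*} [MeasurableSpace Ω] (ρ : Measure Ω) (lam : ι → ℝ)
    (ξ : ι → Ω → ℝ) : Prop where
  measurable : ∀ k, Measurable (ξ k)
  indep : iIndepFun ξ ρ
  prob_one : ∀ k, ρ {ω | ξ k ω = 1} = ENNReal.ofReal (lam k)
  prob_zero : ∀ k, ρ {ω | ξ k ω = 0} = ENNReal.ofReal (1 - lam k)

/-- The random kernel `K_ξ(x, y) = ∑ₖ ξₖ uₖ(x) uₖ(y)^*`. -/
def randomKernel {Λ Ω ι : Type*} (ξ : ι → Ω → ℝ) (u : ι → Λ → ℍ[ℝ]) (ω : Ω) (x y : Λ) : ℍ[ℝ] :=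
  diagSeries (fun k => ξ k ω) u x y

end PfaffianField

end

open PfaffianField

noncomputable section

namespace PfaffianField

section Recursion

open Equiv Equiv.Perm

variable {A : Type*} [Ring A] {n : ℕ}

/-- The matrix obtained by deleting the row and the column of index `0`. -/
def minorZero {A : Type*} {n : ℕ} (X : Matrix (Fin (n + 1)) (Fin (n + 1)) A) :
    Matrix (Fin n) (Fin n) A :=
  X.submatrix Fin.succ Fin.succ

/-- The ordered product of the entries of `X` along `s` steps of the orbit of `i` under `σ`. -/
def pathProd (X : Matrix (Fin n) (Fin n) A) (σ : Perm (Fin n)) (i : Fin n) (s : ℕ) : A :=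
  ((List.range s).map fun t => X ((σ ^ t) i) ((σ ^ (t + 1)) i)).prod

lemma pathProd_succ (X : Matrix (Fin n) (Fin n) A) (σ : Perm (Fin n)) (i : Fin n) (s : ℕ) :
    pathProd X σ i (s + 1) = pathProd X σ i s * X ((σ ^ s) i) (σ ((σ ^ s) i)) := by
  simp [pathProd, List.range_succ, pow_succ']

lemma cycleProd_eq_pathProd (X : Matrix (Fin n) (Fin n) A) (σ : Perm (Fin n)) (i : Fin n) :
    cycleProd X σ i = pathProd X σ i (Function.minimalPeriod σ i) := rfl

lemma minimalPeriod_eq_of_first_return {σ : Perm (Fin n)} {i : Fin n} {s : ℕ} (hs : 0 < s)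
    (h : (σ ^ s) i = i) (hr : ∀ r, 0 < r → r < s → (σ ^ r) i ≠ i) :
    Function.minimalPeriod σ i = s := by
  have hp : Function.IsPeriodicPt σ s i := by
    rw [Function.IsPeriodicPt, Function.IsFixedPt, Equiv.Perm.iterate_eq_pow]; exact h
  refine le_antisymm (hp.minimalPeriod_le hs) ?_
  by_contra! hlt
  refine hr _ (hp.minimalPeriod_pos hs) hlt ?_
  have := Function.isPeriodicPt_minimalPeriod σ i
  rwa [Function.IsPeriodicPt, Function.IsFixedPt, Equiv.Perm.iterate_eq_pow] at this

lemma pow_ne_of_lt_minimalPeriod {σ : Perm (Fin n)} {i : Fin n} {r : ℕ} (h0 : 0 < r)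
    (h : r < Function.minimalPeriod σ i) : (σ ^ r) i ≠ i := by
  intro hi
  have hp : Function.IsPeriodicPt σ r i := by
    rw [Function.IsPeriodicPt, Function.IsFixedPt, Equiv.Perm.iterate_eq_pow]; exact hi
  exact absurd (hp.minimalPeriod_le h0) (not_le.2 h)

lemma pow_minimalPeriod (σ : Perm (Fin n)) (i : Fin n) :
    (σ ^ Function.minimalPeriod σ i) i = i := by
  have := Function.isPeriodicPt_minimalPeriod σ i
  rwa [Function.IsPeriodicPt, Function.IsFixedPt, Equiv.Perm.iterate_eq_pow] at this

lemma minimalPeriod_perm_pos (σ : Perm (Fin n)) (i : Fin n) :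
    0 < Function.minimalPeriod σ i := by
  refine Function.minimalPeriod_pos_of_mem_periodicPts ?_
  refine ⟨orderOf σ, orderOf_pos σ, ?_⟩
  rw [Function.IsPeriodicPt, Function.IsFixedPt, Equiv.Perm.iterate_eq_pow, pow_orderOf_eq_one]
  rfl

/-- If every step of `e` lifts to one step of `σ`, or to two steps passing through `0`, then the
orbits of `e` lift to orbits of `σ`. -/
lemma exists_pow_lift {σ : Perm (Fin (n + 1))} {e : Perm (Fin n)}
    (hstep : ∀ x, σ x.succ = (e x).succ ∨ (σ x.succ = 0 ∧ σ 0 = (e x).succ))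
    (i : Fin n) (s : ℕ) : ∃ s', (σ ^ s') i.succ = ((e ^ s) i).succ := by
  induction s with
  | zero => exact ⟨0, by simp⟩
  | succ s ih =>
    obtain ⟨s', h⟩ := ih
    rcases hstep ((e ^ s) i) with h1 | ⟨h1, h2⟩
    · exact ⟨s' + 1, by rw [pow_succ', Perm.mul_apply, h, h1, pow_succ', Perm.mul_apply]⟩
    · exact ⟨s' + 1 + 1, by
        rw [pow_succ', pow_succ', Perm.mul_apply, Perm.mul_apply, h, h1, h2, pow_succ',
          Perm.mul_apply]⟩

/-- If every step of `e` lifts to one step of `σ`, or to two steps passing through `0`, with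
matching matrix entries, then the cycle products agree. -/
lemma cycleProd_lift {X : Matrix (Fin (n + 1)) (Fin (n + 1)) A}
    {Y : Matrix (Fin n) (Fin n) A} {σ : Perm (Fin (n + 1))} {e : Perm (Fin n)}
    (hstep : ∀ x, (σ x.succ = (e x).succ ∧ Y x (e x) = X x.succ (e x).succ) ∨
      (σ x.succ = 0 ∧ σ 0 = (e x).succ ∧ Y x (e x) = X x.succ 0 * X 0 (e x).succ))
    (i : Fin n) : cycleProd X σ i.succ = cycleProd Y e i := by
  have key : ∀ s, (∀ r, 0 < r → r < s → (e ^ r) i ≠ i) → ∃ s', s ≤ s' ∧ (s = 0 → s' = 0) ∧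
      (σ ^ s') i.succ = ((e ^ s) i).succ ∧ pathProd X σ i.succ s' = pathProd Y e i s ∧
      ∀ r, 0 < r → r < s' → (σ ^ r) i.succ ≠ i.succ := by
    intro s
    induction s with
    | zero => exact fun _ => ⟨0, le_rfl, by simp, by simp, by simp [pathProd], by omega⟩
    | succ s ih =>
      intro hr
      obtain ⟨s', hs, h0, h1, h2, h3⟩ := ih fun r h0 h => hr r h0 (by omega)
      have hne : 0 < s' → (σ ^ s') i.succ ≠ i.succ := by
        intro hpos
        rw [h1]
        exact fun hh => hr s (by omega) (by omega) (Fin.succ_injective _ hh)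
      have hlast : ∀ r, 0 < r → r < s' + 1 → (σ ^ r) i.succ ≠ i.succ := by
        intro r hr0 hr1
        rcases Nat.lt_succ_iff_lt_or_eq.1 hr1 with h | rfl
        · exact h3 r hr0 h
        · exact hne hr0
      rcases hstep ((e ^ s) i) with ⟨ha, hb⟩ | ⟨ha, hb, hc⟩
      · refine ⟨s' + 1, by omega, by omega, ?_, ?_, hlast⟩
        · rw [pow_succ', Perm.mul_apply, h1, ha, pow_succ', Perm.mul_apply]
        · rw [pathProd_succ, pathProd_succ, h2, h1, ha, hb]
      · have hz : (σ ^ (s' + 1)) i.succ = 0 := by rw [pow_succ', Perm.mul_apply, h1, ha]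
        refine ⟨s' + 1 + 1, by omega, by omega, ?_, ?_, ?_⟩
        · rw [pow_succ', Perm.mul_apply, hz, hb, pow_succ', Perm.mul_apply]
        · rw [pathProd_succ, pathProd_succ, pathProd_succ, h2, hz, h1, ha, hb, hc, mul_assoc]
        · intro r hr0 hr1
          rcases Nat.lt_succ_iff_lt_or_eq.1 hr1 with h | rfl
          · exact hlast r hr0 h
          · rw [hz]
            exact (Fin.succ_ne_zero i).symm
  obtain ⟨s', hs, -, h1, h2, h3⟩ := key (Function.minimalPeriod e i)
    fun r h0 h => pow_ne_of_lt_minimalPeriod h0 h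
  rw [pow_minimalPeriod] at h1
  have hpos := minimalPeriod_perm_pos e i
  rw [cycleProd_eq_pathProd, cycleProd_eq_pathProd,
    minimalPeriod_eq_of_first_return (by omega) h1 h3, h2]

/-- If `c` sends every step of `σ` into a cycle of `e`, then it maps cycles of `σ` to cycles
of `e`. -/
lemma sameCycle_of_collapse {σ : Perm (Fin (n + 1))} {e : Perm (Fin n)}
    {c : Fin (n + 1) → Fin n} (hc : ∀ y, e.SameCycle (c y) (c (σ y))) {y z : Fin (n + 1)}
    (h : σ.SameCycle y z) : e.SameCycle (c y) (c z) := by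
  obtain ⟨k, -, hk⟩ := h.exists_pow_eq'
  subst hk
  clear h
  induction k with
  | zero => exact SameCycle.refl _ _
  | succ k ih =>
    rw [pow_succ', Perm.mul_apply]
    exact ih.trans (hc _)

lemma SameCycle.exists_pow {σ : Perm (Fin n)} {x y : Fin n} (h : σ.SameCycle x y) :
    ∃ k : ℕ, (σ ^ k) x = y := by
  obtain ⟨k, -, hk⟩ := h.exists_pow_eq'
  exact ⟨k, hk⟩

/-- The term of the Moore-Dyson determinant of a permutation which fixes `0`. -/
lemma mooreTerm_decomposeFin_zero (X : Matrix (Fin (n + 1)) (Fin (n + 1)) A) (e : Perm (Fin n)) :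
    ((cycleLeaders (decomposeFin.symm (0, e))).map
        (cycleProd X (decomposeFin.symm (0, e)))).prod =
      ((cycleLeaders e).map (cycleProd (minorZero X) e)).prod * X 0 0 := by
  set σ := decomposeFin.symm ((0 : Fin (n + 1)), e) with hσ
  have h0 : σ 0 = 0 := by simp [hσ]
  have hs : ∀ x, σ (Fin.succ x) = (e x).succ := fun x => by simp [hσ]
  have hpow0 : ∀ k : ℕ, (σ ^ k) 0 = 0 := fun k => by
    induction k with
    | zero => rfl
    | succ k ih => rw [pow_succ', Perm.mul_apply, ih, h0]
  have hpow : ∀ (k : ℕ) x, (σ ^ k) (Fin.succ x) = ((e ^ k) x).succ := fun k x => by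
    induction k with
    | zero => rfl
    | succ k ih => rw [pow_succ', Perm.mul_apply, ih, hs, pow_succ', Perm.mul_apply]
  have hlead0 : ∀ j, σ.SameCycle 0 j → j ≤ 0 := by
    intro j hj
    obtain ⟨k, hk⟩ := SameCycle.exists_pow hj
    rw [← hk, hpow0]
  have hlead : ∀ i : Fin n, (∀ j, σ.SameCycle i.succ j → j ≤ i.succ) ↔
      ∀ j, e.SameCycle i j → j ≤ i := by
    intro i
    constructor
    · intro h j hj
      obtain ⟨k, hk⟩ := SameCycle.exists_pow hj
      have : σ.SameCycle i.succ j.succ := ⟨k, by rw [zpow_natCast, hpow, hk]⟩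
      exact Fin.succ_le_succ_iff.1 (h _ this)
    · intro h j hj
      obtain ⟨k, hk⟩ := SameCycle.exists_pow hj
      rw [← hk, hpow]
      exact Fin.succ_le_succ_iff.2 (h _ ⟨k, by simp⟩)
  have hc0 : cycleProd X σ 0 = X 0 0 := by
    rw [cycleProd_eq_pathProd, minimalPeriod_eq_of_first_return one_pos (by simpa using h0)
      (by omega)]
    simp [pathProd, h0]
  have hc : ∀ i : Fin n, cycleProd X σ i.succ = cycleProd (minorZero X) e i :=
    cycleProd_lift fun x => Or.inl ⟨hs x, rfl⟩
  have hL : cycleLeaders σ = (cycleLeaders e).map Fin.succ ++ [0] := by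
    simp only [cycleLeaders, List.finRange_succ, List.reverse_cons, List.filter_append,
      ← List.map_reverse, List.filter_map]
    congr 1
    · congr 1
      refine List.filter_congr fun i _ => ?_
      simp only [Function.comp, hlead]
    · simp only [List.filter_cons, List.filter_nil]
      rw [if_pos (by simpa using hlead0)]
  rw [hL]
  simp [hc0, hc, Function.comp_def]

/-- The term of a permutation which has `0` inserted into the cycles of `e` right after `i`. -/
lemma mooreTerm_decomposeFin_succ (X : Matrix (Fin (n + 1)) (Fin (n + 1)) A) (e : Perm (Fin n))
    (i : Fin n) :
    ((cycleLeaders (decomposeFin.symm ((e i).succ, e))).map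
        (cycleProd X (decomposeFin.symm ((e i).succ, e)))).prod =
      ((cycleLeaders e).map (cycleProd ((minorZero X).updateRow i
        fun j => X i.succ 0 * X 0 j.succ) e)).prod := by
  set σ := decomposeFin.symm ((e i).succ, e) with hσ
  have h0 : σ 0 = (e i).succ := by simp [hσ]
  have hi : σ i.succ = 0 := by simp [hσ]
  have hs : ∀ x, x ≠ i → σ (Fin.succ x) = (e x).succ := fun x hx => by
    rw [hσ, decomposeFin_symm_apply_succ, swap_apply_of_ne_of_ne (Fin.succ_ne_zero _)]
    exact fun h => hx (e.injective (Fin.succ_injective _ h))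
  have hstep : ∀ x, σ x.succ = (e x).succ ∨ (σ x.succ = 0 ∧ σ 0 = (e x).succ) := by
    intro x
    by_cases hx : x = i
    · subst hx; exact Or.inr ⟨hi, h0⟩
    · exact Or.inl (hs x hx)
  have hcol : ∀ y, e.SameCycle (Fin.cases (e i) id y : Fin n)
      (Fin.cases (e i) id (σ y) : Fin n) := by
    intro y
    refine Fin.cases ?_ (fun x => ?_) y
    · rw [h0]; exact SameCycle.refl _ _
    · by_cases hx : x = i
      · subst hx
        rw [hi]
        exact ⟨1, by simp⟩
      · rw [hs x hx]
        exact ⟨1, by simp⟩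
  have hlead0 : ¬ ∀ j, σ.SameCycle 0 j → j ≤ 0 := by
    intro h
    exact absurd (h (e i).succ ⟨1, by simpa using h0⟩) (by simp)
  have hlead : ∀ i : Fin n, (∀ j, σ.SameCycle i.succ j → j ≤ i.succ) ↔
      ∀ j, e.SameCycle i j → j ≤ i := by
    intro i
    constructor
    · intro h j hj
      obtain ⟨k, hk⟩ := SameCycle.exists_pow hj
      obtain ⟨s', hs'⟩ := exists_pow_lift hstep i k
      have : σ.SameCycle i.succ j.succ := ⟨s', by rw [zpow_natCast, hs', hk]⟩
      exact Fin.succ_le_succ_iff.1 (h _ this)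
    · intro h j hj
      refine Fin.cases (fun _ => Fin.zero_le _) (fun j hj => ?_) j hj
      exact Fin.succ_le_succ_iff.2 (h _ (sameCycle_of_collapse hcol hj))
  have hc : ∀ k : Fin n, cycleProd X σ k.succ = cycleProd ((minorZero X).updateRow i
        fun j => X i.succ 0 * X 0 j.succ) e k := by
    refine cycleProd_lift fun x => ?_
    by_cases hx : x = i
    · subst hx
      exact Or.inr ⟨hi, h0, by simp⟩
    · exact Or.inl ⟨hs x hx, by rw [Matrix.updateRow_ne hx]; rfl⟩
  have hL : cycleLeaders σ = (cycleLeaders e).map Fin.succ := by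
    simp only [cycleLeaders, List.finRange_succ, List.reverse_cons, List.filter_append,
      ← List.map_reverse, List.filter_map]
    rw [List.filter_cons, if_neg (by simpa using hlead0), List.filter_nil, List.append_nil]
    congr 1
    refine List.filter_congr fun i _ => ?_
    simp only [Function.comp, hlead]
  rw [hL]
  simp [hc, Function.comp_def]

/-- Expansion of the Moore-Dyson determinant along the smallest index. -/
theorem mooreDet_succ (X : Matrix (Fin (n + 1)) (Fin (n + 1)) A) :
    mooreDet X = mooreDet (minorZero X) * X 0 0 -
      ∑ i, mooreDet ((minorZero X).updateRow i fun j => X i.succ 0 * X 0 j.succ) := by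
  unfold mooreDet
  rw [← decomposeFin.symm.sum_comp, Fintype.sum_prod_type, Fin.sum_univ_succ, sub_eq_add_neg,
    Finset.sum_mul]
  congr 1
  · refine Finset.sum_congr rfl fun e _ => ?_
    rw [mooreTerm_decomposeFin_zero, decomposeFin.symm_sign]
    simp [mul_assoc]
  · rw [Finset.sum_comm, Finset.sum_comm (s := Finset.univ (α := Fin n)), ← Finset.sum_neg_distrib]
    refine Finset.sum_congr rfl fun e _ => ?_
    rw [← Equiv.sum_comp e, ← Finset.sum_neg_distrib]
    refine Finset.sum_congr rfl fun i _ => ?_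
    rw [mooreTerm_decomposeFin_succ, decomposeFin.symm_sign]
    simp

theorem mooreDet_zero (X : Matrix (Fin 0) (Fin 0) A) : mooreDet X = 1 := by
  simp [mooreDet, cycleLeaders]

theorem map_mooreDet {B : Type*} [Ring B] (f : A →+* B) (X : Matrix (Fin n) (Fin n) A) :
    f (mooreDet X) = mooreDet (X.map f) := by
  simp only [mooreDet, map_sum, map_zsmul, map_list_prod, List.map_map]
  refine Finset.sum_congr rfl fun σ _ => ?_
  congr 3
  funext i
  simp [cycleProd, map_list_prod, Function.comp_def]

end Recursion

section RowLinear

lemma minorZero_updateRow_zero {A : Type*} {n : ℕ} (X : Matrix (Fin (n + 1)) (Fin (n + 1)) A)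
    (r : Fin (n + 1) → A) : minorZero (X.updateRow 0 r) = minorZero X := by
  ext i j
  simp [minorZero, Matrix.updateRow_ne]

lemma minorZero_updateRow_succ {A : Type*} {n : ℕ} (X : Matrix (Fin (n + 1)) (Fin (n + 1)) A) (k : Fin n)
    (r : Fin (n + 1) → A) :
    minorZero (X.updateRow k.succ r) = (minorZero X).updateRow k fun j => r j.succ := by
  ext i j
  by_cases h : i = k
  · subst h; simp [minorZero]
  · simp [minorZero, Matrix.updateRow_ne, h]

lemma updateRow_comm {A : Type*} {n : ℕ} (X : Matrix (Fin n) (Fin n) A) {i k : Fin n} (h : i ≠ k)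
    (r s : Fin n → A) : (X.updateRow i r).updateRow k s = (X.updateRow k s).updateRow i r :=
  Function.update_comm (β := fun _ => Fin n → A) h r s X

variable {A : Type*} [Ring A]

lemma mooreDet_updateRow_zero {n : ℕ} (X : Matrix (Fin (n + 1)) (Fin (n + 1)) A)
    (r : Fin (n + 1) → A) :
    mooreDet (X.updateRow 0 r) = mooreDet (minorZero X) * r 0 -
      ∑ i, mooreDet ((minorZero X).updateRow i fun j => X i.succ 0 * r j.succ) := by
  rw [mooreDet_succ, minorZero_updateRow_zero]
  simp [Matrix.updateRow_ne]

lemma mooreDet_updateRow_succ {n : ℕ} (X : Matrix (Fin (n + 1)) (Fin (n + 1)) A) (k : Fin n)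
    (r : Fin (n + 1) → A) :
    mooreDet (X.updateRow k.succ r) =
      mooreDet ((minorZero X).updateRow k fun j => r j.succ) * X 0 0 -
      (mooreDet ((minorZero X).updateRow k fun j => r 0 * X 0 j.succ) +
      ∑ i ∈ Finset.univ.erase k, mooreDet (((minorZero X).updateRow i
        fun j => X i.succ 0 * X 0 j.succ).updateRow k fun j => r j.succ)) := by
  rw [mooreDet_succ, minorZero_updateRow_succ, ← Finset.add_sum_erase _ _ (Finset.mem_univ k)]
  have h0 : (X.updateRow k.succ r) 0 = X 0 := Matrix.updateRow_ne (Fin.succ_ne_zero k).symm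
  simp only [h0, Matrix.updateRow_self]
  congr 2
  · congr 1
    exact Function.update_idem (β := fun _ => Fin n → A) _ _ _
  · refine Finset.sum_congr rfl fun i hi => ?_
    have hik := Finset.ne_of_mem_erase hi
    rw [updateRow_comm _ hik.symm, Matrix.updateRow_ne (by simpa using hik)]

variable [Algebra ℝ A]

/-- The Moore-Dyson determinant is linear in each row. -/
theorem isLinearMap_mooreDet_updateRow {n : ℕ} (X : Matrix (Fin n) (Fin n) A) (i : Fin n) :
    IsLinearMap ℝ fun r : Fin n → A => mooreDet (X.updateRow i r) := by
  induction n with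
  | zero => exact i.elim0
  | succ n ih =>
    have hadd : ∀ (Y : Matrix (Fin n) (Fin n) A) i (r s : Fin n → A),
        mooreDet (Y.updateRow i fun j => r j + s j) =
          mooreDet (Y.updateRow i r) + mooreDet (Y.updateRow i s) := fun Y i => (ih Y i).map_add
    have hsmul : ∀ (Y : Matrix (Fin n) (Fin n) A) i (c : ℝ) (r : Fin n → A),
        mooreDet (Y.updateRow i fun j => c • r j) = c • mooreDet (Y.updateRow i r) :=
      fun Y i => (ih Y i).map_smul
    refine Fin.cases ⟨fun r s => ?_, fun c r => ?_⟩ (fun k => ⟨fun r s => ?_, fun c r => ?_⟩) i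
    · simp only [mooreDet_updateRow_zero, Pi.add_apply, mul_add, hadd, Finset.sum_add_distrib]
      abel
    · simp only [mooreDet_updateRow_zero, Pi.smul_apply, mul_smul_comm, hsmul, ← Finset.smul_sum,
        smul_sub]
    · simp only [mooreDet_updateRow_succ, Pi.add_apply, add_mul, hadd, Finset.sum_add_distrib]
      abel
    · simp only [mooreDet_updateRow_succ, Pi.smul_apply, smul_mul_assoc, hsmul,
        ← Finset.smul_sum, smul_sub, smul_add]

/-- The Moore-Dyson determinant as a multilinear map of the rows. -/
def mooreDetMultilinear (A : Type*) [Ring A] [Algebra ℝ A] (n : ℕ) :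
    MultilinearMap ℝ (fun _ : Fin n => Fin n → A) A where
  toFun X := mooreDet X
  map_update_add' {inst} X i r s := by
    rw [Subsingleton.elim inst (instDecidableEqFin n)]
    exact (isLinearMap_mooreDet_updateRow X i).map_add r s
  map_update_smul' {inst} X i c r := by
    rw [Subsingleton.elim inst (instDecidableEqFin n)]
    exact (isLinearMap_mooreDet_updateRow X i).map_smul c r

end RowLinear

theorem continuous_mooreDet {A : Type*} [Ring A] [TopologicalSpace A] [IsTopologicalRing A]
    (n : ℕ) : Continuous fun X : Matrix (Fin n) (Fin n) A => mooreDet X := by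
  unfold mooreDet
  refine continuous_finsetSum _ fun σ _ => Continuous.zsmul ?_ _
  refine continuous_list_prod _ fun i _ => ?_
  unfold cycleProd
  refine continuous_list_prod _ fun s _ => ?_
  exact continuous_id.matrix_elem _ _

theorem hasDerivAt_mooreDet {n : ℕ} (X Y : Matrix (Fin n) (Fin n) ℍ[ℝ]) :
    HasDerivAt (fun t : ℝ => mooreDet (X + t • Y)) (∑ i, mooreDet (X.updateRow i (Y i))) 0 := by
  let f : ContinuousMultilinearMap ℝ (fun _ : Fin n => Fin n → ℍ[ℝ]) ℍ[ℝ] :=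
    ⟨mooreDetMultilinear ℍ[ℝ] n, continuous_mooreDet n⟩
  let X' : Fin n → Fin n → ℍ[ℝ] := X
  let Y' : Fin n → Fin n → ℍ[ℝ] := Y
  have hl : HasDerivAt (fun t : ℝ => X' + t • Y') Y' 0 := by
    simpa using ((hasDerivAt_id (0 : ℝ)).smul_const Y').const_add X'
  have := HasFDerivAt.comp_hasDerivAt_of_eq (0 : ℝ) (f.hasFDerivAt X') hl (by simp)
  rw [ContinuousMultilinearMap.linearDeriv_apply] at this
  exact this

section RankOne

/-- The matrix `v v^*`. -/
def outer {n : ℕ} (v : Fin n → ℍ[ℝ]) : Matrix (Fin n) (Fin n) ℍ[ℝ] :=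
  Matrix.of fun i j => v i * star (v j)

lemma outer_isHermitian {n : ℕ} (v : Fin n → ℍ[ℝ]) : (outer v).IsHermitian := by
  ext i j : 1
  simp [outer, Matrix.conjTranspose_apply]

lemma isHermitian_smul {n : ℕ} {X : Matrix (Fin n) (Fin n) ℍ[ℝ]} (h : X.IsHermitian) (t : ℝ) :
    (t • X).IsHermitian := by
  ext i j : 1
  rw [Matrix.conjTranspose_apply, Matrix.smul_apply, Matrix.smul_apply, Quaternion.star_smul,
    h.apply]

/-- The first column of `X` without its first entry. -/
def colZero {n : ℕ} (X : Matrix (Fin (n + 1)) (Fin (n + 1)) ℍ[ℝ]) (i : Fin n) : ℍ[ℝ] := X i.succ 0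

lemma isHermitian_minorZero {n : ℕ} {X : Matrix (Fin (n + 1)) (Fin (n + 1)) ℍ[ℝ]}
    (h : X.IsHermitian) : (minorZero X).IsHermitian := h.submatrix _

lemma isHermitian_diag {n : ℕ} {X : Matrix (Fin n) (Fin n) ℍ[ℝ]}
    (h : X.IsHermitian) (i : Fin n) : X i i = ((X i i).re : ℍ[ℝ]) :=
  Quaternion.star_eq_self.1 (h.apply i i)

lemma mooreDet_succ_of_isHermitian {n : ℕ} {X : Matrix (Fin (n + 1)) (Fin (n + 1)) ℍ[ℝ]}
    (h : X.IsHermitian) :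
    mooreDet X = (X 0 0).re • mooreDet (minorZero X) -
      ∑ i, mooreDet ((minorZero X).updateRow i (outer (colZero X) i)) := by
  rw [mooreDet_succ]
  congr 1
  · rw [isHermitian_diag h 0, Quaternion.mul_coe_eq_smul]
    simp
  · refine Finset.sum_congr rfl fun i _ => ?_
    congr 2
    funext j
    simp [outer, colZero, h.apply]

/-- The Moore-Dyson determinants of Hermitian matrices of size `n` are affine along rank one
Hermitian perturbations. -/
def MooreDetAffine (n : ℕ) : Prop :=
  ∀ (X : Matrix (Fin n) (Fin n) ℍ[ℝ]) (v : Fin n → ℍ[ℝ]) (t : ℝ), X.IsHermitian →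
    mooreDet (X + t • outer v) = mooreDet X + t • (mooreDet (X + outer v) - mooreDet X)

lemma MooreDetAffine.sum_updateRow {n : ℕ} (hA : MooreDetAffine n)
    {X : Matrix (Fin n) (Fin n) ℍ[ℝ]} (hX : X.IsHermitian) (v : Fin n → ℍ[ℝ]) :
    ∑ i, mooreDet (X.updateRow i (outer v i)) = mooreDet (X + outer v) - mooreDet X := by
  have h1 := hasDerivAt_mooreDet X (outer v)
  have h2 : HasDerivAt (fun t : ℝ => mooreDet (X + t • outer v))
      (mooreDet (X + outer v) - mooreDet X) 0 := by
    simp_rw [hA X v _ hX]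
    simpa using ((hasDerivAt_id (0 : ℝ)).smul_const
      (mooreDet (X + outer v) - mooreDet X)).const_add (mooreDet X)
  exact h1.unique h2

lemma MooreDetAffine.mooreDet_succ {n : ℕ} (hA : MooreDetAffine n)
    {X : Matrix (Fin (n + 1)) (Fin (n + 1)) ℍ[ℝ]} (h : X.IsHermitian) :
    mooreDet X = (X 0 0).re • mooreDet (minorZero X) -
      (mooreDet (minorZero X + outer (colZero X)) - mooreDet (minorZero X)) := by
  rw [mooreDet_succ_of_isHermitian h, hA.sum_updateRow (isHermitian_minorZero h)]

/-- The Schur complement of the entry of index `0`. -/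
def schurZero {n : ℕ} (X : Matrix (Fin (n + 1)) (Fin (n + 1)) ℍ[ℝ]) : Matrix (Fin n) (Fin n) ℍ[ℝ] :=
  minorZero X + (-(X 0 0).re⁻¹) • outer (colZero X)

lemma isHermitian_schurZero {n : ℕ} {X : Matrix (Fin (n + 1)) (Fin (n + 1)) ℍ[ℝ]}
    (h : X.IsHermitian) : (schurZero X).IsHermitian :=
  (isHermitian_minorZero h).add (isHermitian_smul (outer_isHermitian _) _)

lemma MooreDetAffine.mooreDet_schur {n : ℕ} (hA : MooreDetAffine n)
    {X : Matrix (Fin (n + 1)) (Fin (n + 1)) ℍ[ℝ]} (h : X.IsHermitian) (ha : (X 0 0).re ≠ 0) :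
    mooreDet X = (X 0 0).re • mooreDet (schurZero X) := by
  rw [hA.mooreDet_succ h, schurZero, hA _ _ _ (isHermitian_minorZero h), smul_add, smul_smul,
    mul_neg, mul_inv_cancel₀ ha, neg_one_smul, sub_eq_add_neg]

lemma minorZero_add_smul_outer {n : ℕ} (X : Matrix (Fin (n + 1)) (Fin (n + 1)) ℍ[ℝ])
    (v : Fin (n + 1) → ℍ[ℝ]) (t : ℝ) :
    minorZero (X + t • outer v) = minorZero X + t • outer fun i => v i.succ := rfl

lemma re_add_smul_outer {n : ℕ} (X : Matrix (Fin n) (Fin n) ℍ[ℝ])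
    (v : Fin n → ℍ[ℝ]) (t : ℝ) (i : Fin n) :
    ((X + t • outer v) i i).re = (X i i).re + t * Quaternion.normSq (v i) := by
  simp [outer, Quaternion.self_mul_star]

lemma schurZero_add_smul_outer {n : ℕ} (X : Matrix (Fin (n + 1)) (Fin (n + 1)) ℍ[ℝ])
    (v : Fin (n + 1) → ℍ[ℝ]) (t : ℝ) (ha : (X 0 0).re ≠ 0)
    (hb : (X 0 0).re + t * Quaternion.normSq (v 0) ≠ 0) :
    schurZero (X + t • outer v) = schurZero X +
      (t * ((X 0 0).re * ((X 0 0).re + t * Quaternion.normSq (v 0)))⁻¹) •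
        outer fun i => (X 0 0).re • v i.succ - X i.succ 0 * v 0 := by
  rw [schurZero, re_add_smul_outer, schurZero, minorZero_add_smul_outer]
  set a := (X 0 0).re
  set c := Quaternion.normSq (v 0) with hc
  ext i j : 1
  have e1 : ∀ p q : ℍ[ℝ], p * v 0 * (star (v 0) * q) = c • (p * q) := fun p q => by
    rw [mul_assoc, ← mul_assoc (v 0), Quaternion.self_mul_star, Quaternion.coe_mul_eq_smul,
      mul_smul_comm]
  have e2 : ∀ p q : ℍ[ℝ], p * star (v 0) * (v 0 * q) = c • (p * q) := fun p q => by
    rw [mul_assoc, ← mul_assoc (star (v 0)), Quaternion.star_mul_self, Quaternion.coe_mul_eq_smul,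
      mul_smul_comm]
  simp only [outer, colZero, Matrix.add_apply, Matrix.smul_apply, Matrix.of_apply, star_add,
    star_sub, star_mul, star_star, Quaternion.star_smul, mul_add, add_mul, mul_sub, sub_mul,
    smul_mul_assoc, mul_smul_comm, e1, e2, smul_add, smul_sub, smul_smul]
  simp only [← mul_assoc]
  match_scalars <;> field_simp <;> ring

lemma MooreDetAffine.mooreDet_add_corner {n : ℕ} (hA : MooreDetAffine n)
    {Y : Matrix (Fin (n + 1)) (Fin (n + 1)) ℍ[ℝ]} (hY : Y.IsHermitian) (s : ℝ) :
    mooreDet (Y + s • outer (Pi.single 0 1)) = mooreDet Y + s • mooreDet (minorZero Y) := by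
  have h1 : minorZero (Y + s • outer (Pi.single 0 1)) = minorZero Y := by
    rw [minorZero_add_smul_outer]
    ext i j : 1
    simp [outer]
  have h2 : colZero (Y + s • outer (Pi.single 0 1)) = colZero Y := by
    funext i
    simp [outer, colZero]
  rw [hA.mooreDet_succ (hY.add (isHermitian_smul (outer_isHermitian _) s)), h1, h2,
    hA.mooreDet_succ hY, re_add_smul_outer]
  simp only [Pi.single_eq_same, map_one, mul_one]
  module

lemma MooreDetAffine.succ {n : ℕ} (hA : MooreDetAffine n) : MooreDetAffine (n + 1) := by
  have step : ∀ (X : Matrix (Fin (n + 1)) (Fin (n + 1)) ℍ[ℝ]) (v : Fin (n + 1) → ℍ[ℝ]),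
      X.IsHermitian → (X 0 0).re ≠ 0 → ∃ d : ℍ[ℝ], ∀ t : ℝ,
        (X 0 0).re + t * Quaternion.normSq (v 0) ≠ 0 →
        mooreDet (X + t • outer v) = mooreDet X + t • d := by
    intro X v hX ha
    refine ⟨Quaternion.normSq (v 0) • mooreDet (schurZero X) + (X 0 0).re⁻¹ •
      (mooreDet (schurZero X + outer fun i => (X 0 0).re • v i.succ - X i.succ 0 * v 0) -
        mooreDet (schurZero X)), fun t hb => ?_⟩
    rw [hA.mooreDet_schur (hX.add (isHermitian_smul (outer_isHermitian v) t))
      (by rwa [re_add_smul_outer]), schurZero_add_smul_outer X v t ha hb, re_add_smul_outer,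
      hA _ _ _ (isHermitian_schurZero hX), hA.mooreDet_schur hX ha]
    set a := (X 0 0).re
    set c := Quaternion.normSq (v 0)
    match_scalars <;> field_simp
    ring
  intro X v t hX
  let E : Matrix (Fin (n + 1)) (Fin (n + 1)) ℍ[ℝ] := outer (Pi.single 0 1)
  have hadd : ∀ (Y : Matrix (Fin (n + 1)) (Fin (n + 1)) ℍ[ℝ]) (s : ℝ), Y.IsHermitian →
      mooreDet (Y + s • E) = mooreDet Y + s • mooreDet (minorZero Y) :=
    fun Y s hY => hA.mooreDet_add_corner hY s
  set c := Quaternion.normSq (v 0)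
  have hc : 0 ≤ c := Quaternion.normSq_nonneg
  set s := 1 + |(X 0 0).re| + |t| * c + c
  have hs : ((X + s • E) 0 0).re = (X 0 0).re + s := by
    rw [re_add_smul_outer]; simp
  have htc : -(|t| * c) ≤ t * c := by
    rw [← neg_mul]; exact mul_le_mul_of_nonneg_right (neg_abs_le t) hc
  have htc' : 0 ≤ |t| * c := by positivity
  have ha := neg_abs_le (X 0 0).re
  have hv : ∀ r : ℝ, (X + r • outer v).IsHermitian :=
    fun r => hX.add (isHermitian_smul (outer_isHermitian v) r)
  obtain ⟨d, hd⟩ := step (X + s • E) v (hX.add (isHermitian_smul (outer_isHermitian _) s))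
    (by rw [hs]; simp only [s]; linarith)
  rw [hs] at hd
  have h1 := hd t (by simp only [s]; linarith)
  have h2 := hd 1 (by simp only [s]; linarith)
  rw [add_right_comm, hadd _ _ (hv _), hadd _ _ hX, minorZero_add_smul_outer,
    hA _ _ _ (isHermitian_minorZero hX)] at h1
  rw [add_right_comm, hadd _ _ (hv _), hadd _ _ hX, minorZero_add_smul_outer,
    one_smul, one_smul, one_smul] at h2
  rw [eq_sub_of_add_eq h1, eq_sub_of_add_eq h2]
  module

theorem mooreDetAffine (n : ℕ) : MooreDetAffine n := by
  induction n with
  | zero => intro X v t _; simp [mooreDet_zero]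
  | succ n ih => exact ih.succ

theorem mooreDet_add_smul_outer {n : ℕ} {X : Matrix (Fin n) (Fin n) ℍ[ℝ]} (hX : X.IsHermitian)
    (v : Fin n → ℍ[ℝ]) (t : ℝ) :
    mooreDet (X + t • outer v) = mooreDet X + t • (mooreDet (X + outer v) - mooreDet X) :=
  mooreDetAffine n X v t hX

/-- The Moore-Dyson determinant of a Hermitian quaternion matrix is real. -/
theorem mooreDet_eq_coe_re {n : ℕ} {X : Matrix (Fin n) (Fin n) ℍ[ℝ]} (hX : X.IsHermitian) :
    mooreDet X = ((mooreDet X).re : ℍ[ℝ]) := by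
  induction n with
  | zero => simp [mooreDet_zero]
  | succ n ih =>
    rw [(mooreDetAffine n).mooreDet_succ hX, ih (isHermitian_minorZero hX),
      ih ((isHermitian_minorZero hX).add (outer_isHermitian _))]
    simp [Quaternion.coe_mul_eq_smul]

end RankOne

section PosSemidef

/-- Positive semidefinite Hermitian quaternion matrices. -/
def QuatPosSemidef {n : ℕ} (X : Matrix (Fin n) (Fin n) ℍ[ℝ]) : Prop :=
  X.IsHermitian ∧ ∀ y : Fin n → ℍ[ℝ], 0 ≤ (∑ i, ∑ j, star (y i) * X i j * y j).re

lemma outer_quadratic {n : ℕ} (v y : Fin n → ℍ[ℝ]) :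
    ∑ i, ∑ j, star (y i) * outer v i j * y j =
      ((Quaternion.normSq (∑ j, star (v j) * y j) : ℝ) : ℍ[ℝ]) := by
  rw [← Quaternion.star_mul_self, star_sum, Finset.sum_mul_sum]
  simp [outer, mul_assoc]

lemma quatPosSemidef_zero {n : ℕ} : QuatPosSemidef (0 : Matrix (Fin n) (Fin n) ℍ[ℝ]) :=
  ⟨Matrix.isHermitian_zero, by simp⟩

lemma quatPosSemidef_outer {n : ℕ} (v : Fin n → ℍ[ℝ]) : QuatPosSemidef (outer v) :=
  ⟨outer_isHermitian v, fun y => by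
    rw [outer_quadratic, Quaternion.re_coe]; exact Quaternion.normSq_nonneg⟩

lemma QuatPosSemidef.add {n : ℕ} {X Y : Matrix (Fin n) (Fin n) ℍ[ℝ]} (hX : QuatPosSemidef X)
    (hY : QuatPosSemidef Y) : QuatPosSemidef (X + Y) :=
  ⟨hX.1.add hY.1, fun y => by
    simpa [mul_add, add_mul, Finset.sum_add_distrib] using add_nonneg (hX.2 y) (hY.2 y)⟩

lemma quadratic_smul {n : ℕ} (X : Matrix (Fin n) (Fin n) ℍ[ℝ]) (t : ℝ) (y : Fin n → ℍ[ℝ]) :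
    ∑ i, ∑ j, star (y i) * (t • X) i j * y j = t • ∑ i, ∑ j, star (y i) * X i j * y j := by
  simp [Finset.smul_sum]

lemma QuatPosSemidef.smul {n : ℕ} {X : Matrix (Fin n) (Fin n) ℍ[ℝ]} (hX : QuatPosSemidef X)
    {t : ℝ} (ht : 0 ≤ t) : QuatPosSemidef (t • X) :=
  ⟨isHermitian_smul hX.1 t, fun y => by
    rw [quadratic_smul, Quaternion.re_smul]
    exact mul_nonneg ht (hX.2 y)⟩

lemma QuatPosSemidef.diag_nonneg {n : ℕ} {X : Matrix (Fin n) (Fin n) ℍ[ℝ]}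
    (hX : QuatPosSemidef X) (i : Fin n) : 0 ≤ (X i i).re := by
  have h := hX.2 (Pi.single i 1)
  have h2 : ∑ k, ∑ j, star ((Pi.single i 1 : Fin n → ℍ[ℝ]) k) * X k j *
      (Pi.single i 1 : Fin n → ℍ[ℝ]) j = X i i := by
    rw [Finset.sum_eq_single i, Finset.sum_eq_single i]
    · simp
    · intro j _ hj; simp [hj]
    · simp
    · intro j _ hj; simp [hj]
    · simp
  rwa [h2] at h

lemma quadratic_succ {n : ℕ} {X : Matrix (Fin (n + 1)) (Fin (n + 1)) ℍ[ℝ]}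
    (hX : X.IsHermitian) (y : Fin n → ℍ[ℝ]) (y0 : ℍ[ℝ]) :
    ∑ i, ∑ j, star ((Fin.cons y0 y : Fin (n + 1) → ℍ[ℝ]) i) * X i j *
        (Fin.cons y0 y : Fin (n + 1) → ℍ[ℝ]) j =
      (X 0 0).re • (star y0 * y0) + star y0 * (∑ j, star (colZero X j) * y j) +
        star (∑ j, star (colZero X j) * y j) * y0 +
        ∑ i, ∑ j, star (y i) * minorZero X i j * y j := by
  simp only [Fin.sum_univ_succ, Fin.cons_zero, Fin.cons_succ, Finset.sum_add_distrib, star_sum,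
    Finset.mul_sum, Finset.sum_mul, star_mul, colZero, hX.apply, mul_assoc]
  rw [isHermitian_diag hX 0, Quaternion.coe_mul_eq_smul, mul_smul_comm, Quaternion.re_coe]
  simp only [minorZero, Matrix.submatrix_apply]
  abel

lemma QuatPosSemidef.minorZero {n : ℕ} {X : Matrix (Fin (n + 1)) (Fin (n + 1)) ℍ[ℝ]}
    (hX : QuatPosSemidef X) : QuatPosSemidef (minorZero X) :=
  ⟨isHermitian_minorZero hX.1, fun y => by
    have h := hX.2 (Fin.cons 0 y)
    rw [quadratic_succ hX.1] at h
    simpa using h⟩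

lemma QuatPosSemidef.schurZero {n : ℕ} {X : Matrix (Fin (n + 1)) (Fin (n + 1)) ℍ[ℝ]}
    (hX : QuatPosSemidef X) (ha : (X 0 0).re ≠ 0) : QuatPosSemidef (schurZero X) := by
  refine ⟨isHermitian_schurZero hX.1, fun y => ?_⟩
  have h1 : ∑ i, ∑ j, star (y i) * PfaffianField.schurZero X i j * y j =
      ∑ i, ∑ j, star (y i) * PfaffianField.minorZero X i j * y j - (X 0 0).re⁻¹ •
        ((Quaternion.normSq (∑ j, star (colZero X j) * y j) : ℝ) : ℍ[ℝ]) := by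
    rw [← outer_quadratic, ← neg_add_eq_sub, ← neg_smul, ← quadratic_smul,
      ← Finset.sum_add_distrib]
    refine Finset.sum_congr rfl fun i _ => ?_
    rw [← Finset.sum_add_distrib]
    refine Finset.sum_congr rfl fun j _ => ?_
    simp only [PfaffianField.schurZero, Matrix.add_apply, mul_add, add_mul]
    rw [add_comm]
  have h := hX.2 (Fin.cons ((-(X 0 0).re⁻¹) • ∑ j, star (colZero X j) * y j) y)
  rw [quadratic_succ hX.1] at h
  rw [h1]
  set s := ∑ j, star (colZero X j) * y j
  simp only [Quaternion.star_smul, smul_mul_assoc, mul_smul_comm, Quaternion.star_mul_self] at h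
  simp only [Quaternion.re_add, Quaternion.re_sub, Quaternion.re_smul, Quaternion.re_coe,
    smul_eq_mul] at h ⊢
  refine h.trans (le_of_eq ?_)
  field_simp
  ring

theorem mooreDet_nonneg_and_le_prod_diag {n : ℕ} {X : Matrix (Fin n) (Fin n) ℍ[ℝ]}
    (hX : QuatPosSemidef X) :
    0 ≤ (mooreDet X).re ∧ (mooreDet X).re ≤ ∏ i, (X i i).re := by
  induction n with
  | zero => simp [mooreDet_zero]
  | succ n ih =>
    have pos : ∀ {Y : Matrix (Fin (n + 1)) (Fin (n + 1)) ℍ[ℝ]}, QuatPosSemidef Y →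
        0 < (Y 0 0).re → 0 ≤ (mooreDet Y).re ∧
          (mooreDet Y).re ≤ (Y 0 0).re * ∏ i, (PfaffianField.minorZero Y i i).re := by
      intro Y hY ha
      obtain ⟨h1, h2⟩ := ih (hY.schurZero ha.ne')
      rw [(mooreDetAffine n).mooreDet_schur hY.1 ha.ne', Quaternion.re_smul, smul_eq_mul]
      refine ⟨mul_nonneg ha.le h1, mul_le_mul_of_nonneg_left (h2.trans ?_) ha.le⟩
      refine Finset.prod_le_prod (fun i _ => (hY.schurZero ha.ne').diag_nonneg i) fun i _ => ?_
      rw [PfaffianField.schurZero, re_add_smul_outer]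
      have := mul_nonneg (inv_nonneg.2 ha.le)
        (Quaternion.normSq_nonneg (a := colZero Y i))
      linarith
    rw [Fin.prod_univ_succ]
    have hmin : ∀ i : Fin n, (X i.succ i.succ).re = (PfaffianField.minorZero X i i).re :=
      fun i => rfl
    simp only [hmin]
    rcases (hX.diag_nonneg 0).eq_or_lt with h0 | h0
    · have key : ∀ s : ℝ, 0 < s → 0 ≤ (mooreDet X).re + s * (mooreDet (minorZero X)).re ∧
          (mooreDet X).re + s * (mooreDet (minorZero X)).re ≤
            s * ∏ i, (PfaffianField.minorZero X i i).re := by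
        intro s hs
        have hr : ((X + s • outer (Pi.single 0 1) : Matrix (Fin (n + 1)) (Fin (n + 1)) ℍ[ℝ]) 0 0).re = s := by
          rw [re_add_smul_outer, ← h0]; simp
        have hm : PfaffianField.minorZero (X + s • outer (Pi.single 0 1)) = minorZero X := by
          rw [minorZero_add_smul_outer]
          ext i j : 1
          simp [outer]
        have h := pos (hX.add ((quatPosSemidef_outer (Pi.single 0 1)).smul hs.le))
          (by rw [hr]; exact hs)
        rwa [hr, hm, (mooreDetAffine n).mooreDet_add_corner hX.1, Quaternion.re_add,
          Quaternion.re_smul, smul_eq_mul] at h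
      rw [← h0, zero_mul]
      set d := (mooreDet X).re
      set d' := (mooreDet (minorZero X)).re
      set p := ∏ i, (PfaffianField.minorZero X i i).re
      have hd := (ih hX.minorZero)
      constructor
      · refine le_of_forall_pos_le_add fun ε hε => ?_
        have := (key (ε / (d' + 1)) (div_pos hε (by linarith [hd.1]))).1
        have h3 : ε / (d' + 1) * d' ≤ ε := by
          rw [div_mul_eq_mul_div, div_le_iff₀ (by linarith [hd.1])]
          nlinarith
        linarith
      · refine le_of_forall_pos_le_add fun ε hε => ?_
        have hp : d' ≤ p := hd.2
        have := (key (ε / (p + 1)) (div_pos hε (by linarith [hd.1]))).2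
        have h3 : ε / (p + 1) * p ≤ ε := by
          rw [div_mul_eq_mul_div, div_le_iff₀ (by linarith [hd.1])]
          nlinarith
        have h4 : 0 ≤ ε / (p + 1) * d' := mul_nonneg (div_nonneg hε.le (by linarith [hd.1])) hd.1
        linarith
    · exact pos hX h0

theorem QuatPosSemidef.mooreDet_nonneg {n : ℕ} {X : Matrix (Fin n) (Fin n) ℍ[ℝ]}
    (hX : QuatPosSemidef X) : 0 ≤ (mooreDet X).re := (mooreDet_nonneg_and_le_prod_diag hX).1

/-- Hadamard's inequality. -/
theorem QuatPosSemidef.mooreDet_le_prod_diag {n : ℕ} {X : Matrix (Fin n) (Fin n) ℍ[ℝ]}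
    (hX : QuatPosSemidef X) : (mooreDet X).re ≤ ∏ i, (X i i).re :=
  (mooreDet_nonneg_and_le_prod_diag hX).2

theorem QuatPosSemidef.mooreDet_le_add_smul_outer {n : ℕ} {X : Matrix (Fin n) (Fin n) ℍ[ℝ]}
    (hX : QuatPosSemidef X) (v : Fin n → ℍ[ℝ]) {t : ℝ} (ht : 0 ≤ t) :
    (mooreDet X).re ≤ (mooreDet (X + t • outer v)).re := by
  have h : ∀ s : ℝ, 0 ≤ s → 0 ≤ (mooreDet X).re +
      s * ((mooreDet (X + outer v)).re - (mooreDet X).re) := by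
    intro s hs
    have := (hX.add ((quatPosSemidef_outer v).smul hs)).mooreDet_nonneg
    rwa [mooreDet_add_smul_outer hX.1, Quaternion.re_add, Quaternion.re_smul, Quaternion.re_sub,
      smul_eq_mul] at this
  rw [mooreDet_add_smul_outer hX.1, Quaternion.re_add, Quaternion.re_smul, Quaternion.re_sub,
      smul_eq_mul]
  set d := (mooreDet X).re
  set e := (mooreDet (X + outer v)).re - d
  have hd : 0 ≤ d := hX.mooreDet_nonneg
  have he : 0 ≤ e := by
    by_contra! hneg
    have := h ((d + 1) / (-e)) (div_nonneg (by linarith) (by linarith))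
    rw [div_mul_eq_mul_div, mul_div_assoc, div_neg, div_self hneg.ne] at this
    linarith
  have := mul_nonneg ht he
  linarith

end PosSemidef

section Symmetry

/-- The expansion of the Moore-Dyson determinant along the two smallest indices, in terms of the
diagonal entries `a`, `b`, the product `c` of the two mutual entries, and the matrices `ww`, `zz`,
`wz`, `zw` of the products along paths whose interior points are these indices. -/
def twoStep {n : ℕ} (Y : Matrix (Fin n) (Fin n) ℍ[ℝ]) (a b c : ℝ)
    (ww zz wz zw : Fin n → Fin n → ℍ[ℝ]) : ℍ[ℝ] :=
  (a * b - c) • mooreDet Y - a • (∑ i, mooreDet (Y.updateRow i (zz i))) -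
    b • (∑ i, mooreDet (Y.updateRow i (ww i))) +
    ∑ i, mooreDet (Y.updateRow i (zw i)) + ∑ i, mooreDet (Y.updateRow i (wz i)) +
    ∑ i, ∑ k ∈ Finset.univ.erase i, mooreDet ((Y.updateRow k (ww k)).updateRow i (zz i))

lemma sum_updateRow_updateRow_comm {n : ℕ} (Y : Matrix (Fin n) (Fin n) ℍ[ℝ])
    (r s : Fin n → Fin n → ℍ[ℝ]) :
    ∑ i, ∑ k ∈ Finset.univ.erase i, mooreDet ((Y.updateRow k (r k)).updateRow i (s i)) =
      ∑ i, ∑ k ∈ Finset.univ.erase i, mooreDet ((Y.updateRow k (s k)).updateRow i (r i)) := by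
  rw [Finset.sum_comm' (t' := Finset.univ) (s' := fun k => Finset.univ.erase k)
    (by intro x y; simp [ne_comm])]
  refine Finset.sum_congr rfl fun i _ => Finset.sum_congr rfl fun k hk => ?_
  rw [updateRow_comm _ (Finset.ne_of_mem_erase hk).symm]

lemma twoStep_comm {n : ℕ} (Y : Matrix (Fin n) (Fin n) ℍ[ℝ]) (a b c : ℝ)
    (ww zz wz zw : Fin n → Fin n → ℍ[ℝ]) :
    twoStep Y a b c ww zz wz zw = twoStep Y b a c zz ww zw wz := by
  rw [twoStep, twoStep, sum_updateRow_updateRow_comm, mul_comm a b]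
  abel

lemma mooreDet_eq_twoStep {n : ℕ} {X : Matrix (Fin (n + 2)) (Fin (n + 2)) ℍ[ℝ]}
    (hX : X.IsHermitian) :
    mooreDet X = twoStep (minorZero (minorZero X)) (X 0 0).re (X 1 1).re
      (Quaternion.normSq (X 0 1))
      (fun i j => X i.succ.succ 0 * X 0 j.succ.succ) (fun i j => X i.succ.succ 1 * X 1 j.succ.succ)
      (fun i j => X i.succ.succ 0 * X 0 1 * X 1 j.succ.succ)
      (fun i j => X i.succ.succ 1 * X 1 0 * X 0 j.succ.succ) := by
  have h10 : X 1 0 * X 0 1 = (Quaternion.normSq (X 0 1) : ℝ) := by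
    rw [← hX.apply 1 0, Quaternion.star_mul_self]
  have e1 : minorZero X 0 0 = X 1 1 := rfl
  have e2 : ∀ i : Fin n, minorZero X i.succ 0 = X i.succ.succ 1 := fun i => rfl
  have e3 : ∀ i : Fin n, minorZero X 0 i.succ = X 1 i.succ.succ := fun i => rfl
  rw [mooreDet_succ, mooreDet_succ (minorZero X), Fin.sum_univ_succ, mooreDet_updateRow_zero]
  simp only [mooreDet_updateRow_succ, e1, e2, e3]
  rw [isHermitian_diag hX 0, isHermitian_diag hX 1]
  simp only [Fin.succ_zero_eq_one, h10, Quaternion.mul_coe_eq_smul, Quaternion.re_coe,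
    Finset.sum_sub_distrib, Finset.sum_add_distrib, ← Finset.smul_sum, ← mul_assoc, twoStep]
  rw [sum_updateRow_updateRow_comm]
  module

lemma mooreDet_submatrix_swap_zero_one {n : ℕ} {X : Matrix (Fin (n + 2)) (Fin (n + 2)) ℍ[ℝ]}
    (hX : X.IsHermitian) :
    mooreDet (X.submatrix (Equiv.swap 0 1) (Equiv.swap 0 1)) = mooreDet X := by
  have hs : ∀ i : Fin n, Equiv.swap (0 : Fin (n + 2)) 1 i.succ.succ = i.succ.succ := fun i =>
    Equiv.swap_apply_of_ne_of_ne (Fin.succ_ne_zero _)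
      (by rw [← Fin.succ_zero_eq_one]; exact fun h => Fin.succ_ne_zero _ (Fin.succ_injective _ h))
  have hm : minorZero (minorZero (X.submatrix (Equiv.swap 0 1) (Equiv.swap 0 1))) =
      minorZero (minorZero X) := by
    ext i j : 1
    simp only [minorZero, Matrix.submatrix_apply, hs]
  have hn : Quaternion.normSq (X 1 0) = Quaternion.normSq (X 0 1) := by
    rw [← hX.apply 1 0, Quaternion.normSq_star]
  rw [mooreDet_eq_twoStep (hX.submatrix _), mooreDet_eq_twoStep hX, hm, twoStep_comm]
  simp only [Matrix.submatrix_apply, hs, Equiv.swap_apply_left, Equiv.swap_apply_right, hn]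

/-- The Moore-Dyson determinant of a Hermitian quaternion matrix does not depend on the order of
the indices. -/
theorem mooreDet_submatrix_perm {n : ℕ} {X : Matrix (Fin n) (Fin n) ℍ[ℝ]} (hX : X.IsHermitian)
    (σ : Equiv.Perm (Fin n)) : mooreDet (X.submatrix σ σ) = mooreDet X := by
  induction n with
  | zero => simp [mooreDet_zero]
  | succ n ih =>
    cases n with
    | zero => 
      refine congrArg mooreDet ?_
      ext i j : 1
      rw [Matrix.submatrix_apply, Subsingleton.elim (α := Fin 1) (σ i) i,
        Subsingleton.elim (α := Fin 1) (σ j) j]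
    | succ n =>
      have hmem : σ ∈ Submonoid.closure
          (Set.range fun i : Fin (n + 1) => Equiv.swap i.castSucc i.succ) := by
        rw [Equiv.Perm.mclosure_swap_castSucc_succ]; trivial
      induction hmem using Submonoid.closure_induction generalizing X with
      | one => rfl
      | mul σ τ _ _ h1 h2 =>
        have : X.submatrix (σ * τ) (σ * τ) = (X.submatrix σ σ).submatrix τ τ := rfl
        rw [this, h2 (hX.submatrix _), h1 hX]
      | mem τ hτ =>
        obtain ⟨i, rfl⟩ := hτ
        refine Fin.cases ?_ (fun k => ?_) i
        · exact mooreDet_submatrix_swap_zero_one hX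
        · set τ := Equiv.swap k.succ.castSucc k.succ.succ with hτ
          set e := Equiv.swap k.castSucc k.succ with he
          have h0 : τ 0 = 0 := by
            rw [hτ, Equiv.swap_apply_of_ne_of_ne]
            · rw [← Fin.succ_castSucc]; exact (Fin.succ_ne_zero _).symm
            · exact (Fin.succ_ne_zero _).symm
          have hs : ∀ j, τ (Fin.succ j) = (e j).succ := fun j => by
            rw [hτ, he, ← Fin.succ_castSucc]
            exact ((Fin.succ_injective _).swap_apply _ _ _)
          have hm : minorZero (X.submatrix τ τ) = (minorZero X).submatrix e e := by
            ext i j : 1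
            simp only [minorZero, Matrix.submatrix_apply, hs]
          have hc : minorZero (X.submatrix τ τ) + outer (colZero (X.submatrix τ τ)) =
              (minorZero X + outer (colZero X)).submatrix e e := by
            ext i j : 1
            simp only [minorZero, Matrix.submatrix_apply, hs, h0, colZero, outer, Matrix.add_apply,
              Matrix.of_apply]
          have hmX := isHermitian_minorZero hX
          rw [(mooreDetAffine _).mooreDet_succ (hX.submatrix _), hc, hm, ih hmX,
            ih (hmX.add (outer_isHermitian _)), (mooreDetAffine _).mooreDet_succ hX,
            Matrix.submatrix_apply, h0]

end Symmetry

section ProjectionKernel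

variable {Λ : Type*}

/-- The matrix `(κ(x_i, x_j))`. -/
def kernelMatrix {A : Type*} {n : ℕ} (κ : Λ → Λ → A) (x : Fin n → Λ) : Matrix (Fin n) (Fin n) A :=
  Matrix.of fun i j => κ (x i) (x j)

/-- The real part of the Moore-Dyson determinant of `(κ(x_i, x_j))`. -/
def kernelDet {n : ℕ} (κ : Λ → Λ → ℍ[ℝ]) (x : Fin n → Λ) : ℝ := (mooreDet (kernelMatrix κ x)).re

/-- A positive semidefinite measurable kernel with `∫ κ(x,y) κ(y,z) dμ(y) = κ(x,z)` and trace
`N`. -/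
structure IsProjectionKernel [MeasurableSpace Λ] (μ : Measure Λ) (κ : Λ → Λ → ℍ[ℝ]) (N : ℕ) :
    Prop where
  stronglyMeasurable : StronglyMeasurable fun p : Λ × Λ => κ p.1 p.2
  posSemidef : ∀ (n : ℕ) (x : Fin n → Λ), QuatPosSemidef (kernelMatrix κ x)
  integrable_mul : ∀ x z, Integrable (fun y => κ x y * κ y z) μ
  integral_mul : ∀ x z, ∫ y, κ x y * κ y z ∂μ = κ x z
  integrable_diag : Integrable (fun y => (κ y y).re) μ
  integral_diag : ∫ y, (κ y y).re ∂μ = N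

lemma integrable_re_quaternion {α : Type*} [MeasurableSpace α] {μ : Measure α} {f : α → ℍ[ℝ]}
    (hf : Integrable f μ) : Integrable (fun a => (f a).re) μ := by
  refine hf.norm.mono' (Quaternion.continuous_re.comp_aestronglyMeasurable hf.1) ?_
  refine Filter.Eventually.of_forall fun a => ?_
  have h : ‖(f a).re‖ ^ 2 ≤ ‖f a‖ ^ 2 := by
    rw [Real.norm_eq_abs, sq_abs, sq ‖f a‖, ← Quaternion.normSq_eq_norm_mul_self,
      Quaternion.normSq_def']
    nlinarith [sq_nonneg (f a).imI, sq_nonneg (f a).imJ, sq_nonneg (f a).imK]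
  exact abs_le_of_sq_le_sq' h (norm_nonneg _) |>.2

lemma integral_re_quaternion {α : Type*} [MeasurableSpace α] {μ : Measure α} {f : α → ℍ[ℝ]}
    (hf : Integrable f μ) : (∫ a, f a ∂μ).re = ∫ a, (f a).re ∂μ := by
  let L : ℍ[ℝ] →L[ℝ] ℝ := LinearMap.toContinuousLinearMap
    ⟨⟨fun q => q.re, fun _ _ => rfl⟩, fun _ _ => rfl⟩
  exact (L.integral_comp_comm hf).symm

lemma kernelDet_nonneg [MeasurableSpace Λ] {μ : Measure Λ} {κ : Λ → Λ → ℍ[ℝ]} {N : ℕ}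
    (h : IsProjectionKernel μ κ N) {n : ℕ} (x : Fin n → Λ) : 0 ≤ kernelDet κ x :=
  (h.posSemidef n x).mooreDet_nonneg

lemma kernelDet_comp_perm {κ : Λ → Λ → ℍ[ℝ]} {n : ℕ} {x : Fin n → Λ}
    (hκ : (kernelMatrix κ x).IsHermitian) (σ : Equiv.Perm (Fin n)) :
    kernelDet κ (x ∘ σ) = kernelDet κ x :=
  congrArg (·.re) (mooreDet_submatrix_perm hκ σ)

variable [MeasurableSpace Λ] {μ : Measure Λ}

lemma measurable_re_mooreDet {α : Type*} [MeasurableSpace α] {n : ℕ}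
    {F : α → Matrix (Fin n) (Fin n) ℍ[ℝ]} (hF : ∀ i j, StronglyMeasurable fun a => F a i j) :
    Measurable fun a => (mooreDet (F a)).re := by
  let _ : MeasurableSpace ℍ[ℝ] := borel _
  have : BorelSpace ℍ[ℝ] := ⟨rfl⟩
  have h1 : Measurable fun a => (fun i j => F a i j : Fin n → Fin n → ℍ[ℝ]) :=
    measurable_pi_lambda _ fun i => measurable_pi_lambda _ fun j => (hF i j).measurable
  have h2 : Continuous fun X : Fin n → Fin n → ℍ[ℝ] => (mooreDet (Matrix.of X)).re :=
    Quaternion.continuous_re.comp (continuous_mooreDet n)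
  exact h2.measurable.comp h1

lemma measurable_kernelDet {κ : Λ → Λ → ℍ[ℝ]}
    (h : StronglyMeasurable fun p : Λ × Λ => κ p.1 p.2) (n : ℕ) :
    Measurable fun x : Fin n → Λ => kernelDet κ x := by
  refine measurable_re_mooreDet fun i j => ?_
  simp only [kernelMatrix, Matrix.of_apply]
  exact h.comp_measurable (g := fun x : Fin n → Λ => (x i, x j)) ((measurable_pi_apply i).prodMk (measurable_pi_apply j))

lemma integral_kernelDet_cons {κ : Λ → Λ → ℍ[ℝ]} {N : ℕ} (h : IsProjectionKernel μ κ N)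
    {n : ℕ} (x : Fin n → Λ) :
    Integrable (fun y => kernelDet κ (Fin.cons y x : Fin (n + 1) → Λ)) μ ∧
    ∫ y, kernelDet κ (Fin.cons y x : Fin (n + 1) → Λ) ∂μ = (N - n) * kernelDet κ x := by
  set X := kernelMatrix κ x
  have hX : X.IsHermitian := (h.posSemidef n x).1
  let L : Fin n → (Fin n → ℍ[ℝ]) →L[ℝ] ℍ[ℝ] := fun i =>
    LinearMap.toContinuousLinearMap (isLinearMap_mooreDet_updateRow X i).mk'
  have hL : ∀ i r, L i r = mooreDet (X.updateRow i r) := fun i r => rfl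
  have hexp : ∀ y, mooreDet (kernelMatrix κ (Fin.cons y x : Fin (n + 1) → Λ)) =
      (κ y y).re • mooreDet X - ∑ i, L i fun j => κ (x i) y * κ y (x j) := by
    intro y
    have hY := (h.posSemidef (n + 1) (Fin.cons y x)).1
    rw [mooreDet_succ_of_isHermitian hY]
    congr 1
    refine Finset.sum_congr rfl fun i _ => ?_
    rw [hL]
    congr 2
    funext j
    have := hY.apply 0 j.succ
    simp only [kernelMatrix, Matrix.of_apply, Fin.cons_zero, Fin.cons_succ] at this
    simp [outer, colZero, kernelMatrix, this]
  have hint : ∀ i, Integrable (fun y => fun j => κ (x i) y * κ y (x j)) μ := fun i =>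
    Integrable.of_eval fun j => h.integrable_mul _ _
  have hval : ∀ i, ∫ y, L i (fun j => κ (x i) y * κ y (x j)) ∂μ = mooreDet X := by
    intro i
    rw [(L i).integral_comp_comm (hint i), hL]
    congr 1
    have : (∫ y, (fun j => κ (x i) y * κ y (x j)) ∂μ) = X i := by
      funext j
      rw [eval_integral fun j => h.integrable_mul _ _, h.integral_mul]
      rfl
    rw [this, Matrix.updateRow_eq_self]
  have hI1 : Integrable (fun y => (κ y y).re • mooreDet X) μ := h.integrable_diag.smul_const _
  have hI2 : ∀ i, Integrable (fun y => L i fun j => κ (x i) y * κ y (x j)) μ :=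
    fun i => (L i).integrable_comp (hint i)
  have hI : Integrable (fun y => (κ y y).re • mooreDet X -
      ∑ i, L i fun j => κ (x i) y * κ y (x j)) μ :=
    hI1.sub (integrable_finsetSum _ fun i _ => hI2 i)
  have hre := integral_re_quaternion hI
  rw [integral_sub hI1 (integrable_finsetSum _ fun i _ => hI2 i),
    integral_finsetSum _ fun i _ => hI2 i, integral_smul_const, h.integral_diag] at hre
  simp only [kernelDet, hexp]
  refine ⟨integrable_re_quaternion hI, ?_⟩
  rw [← hre]
  simp only [hval]
  simp [sub_mul, X]

/-- Dyson's integration formula, in terms of nonnegative integrals. -/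
lemma lintegral_kernelDet_cons {κ : Λ → Λ → ℍ[ℝ]} {N : ℕ} (h : IsProjectionKernel μ κ N)
    {n : ℕ} (hn : n ≤ N) (x : Fin n → Λ) :
    ∫⁻ y, ENNReal.ofReal (kernelDet κ (Fin.cons y x : Fin (n + 1) → Λ)) ∂μ =
      ((N - n : ℕ) : ℝ≥0∞) * ENNReal.ofReal (kernelDet κ x) := by
  obtain ⟨h1, h2⟩ := integral_kernelDet_cons h x
  rw [← ofReal_integral_eq_lintegral_ofReal h1
    (Filter.Eventually.of_forall fun y => kernelDet_nonneg h _), h2,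
    ENNReal.ofReal_mul (by rw [sub_nonneg]; exact_mod_cast hn)]
  congr 1
  rw [← Nat.cast_sub hn, ENNReal.ofReal_natCast]

lemma kernelDet_eq_zero {κ : Λ → Λ → ℍ[ℝ]} {N : ℕ} (h : IsProjectionKernel μ κ N)
    {n : ℕ} (hn : N < n) (x : Fin n → Λ) : kernelDet κ x = 0 := by
  have h1 : 0 ≤ ((N : ℝ) - n) * kernelDet κ x := by
    rw [← (integral_kernelDet_cons h x).2]
    exact integral_nonneg fun y => kernelDet_nonneg h _
  have h2 : (N : ℝ) < n := by exact_mod_cast hn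
  have h3 := kernelDet_nonneg h x
  by_contra hne
  have : 0 < kernelDet κ x := lt_of_le_of_ne h3 (Ne.symm hne)
  nlinarith

/-- The last `k` of `n` indices. -/
def lastIndex {k n : ℕ} (h : k ≤ n) (i : Fin k) : Fin n := ⟨n - k + i, by omega⟩

variable [SigmaFinite μ]

lemma lintegral_pi_succ {n : ℕ} {f : (Fin (n + 1) → Λ) → ℝ≥0∞} (hf : Measurable f) :
    ∫⁻ x, f x ∂(Measure.pi fun _ : Fin (n + 1) => μ) =
      ∫⁻ x, ∫⁻ y, f (Fin.cons y x : Fin (n + 1) → Λ) ∂μ ∂(Measure.pi fun _ : Fin n => μ) := by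
  have hmp := (measurePreserving_piFinSuccAbove (fun _ : Fin (n + 1) => μ) 0).symm
  rw [← hmp.lintegral_comp hf, lintegral_prod_symm _ ?_]
  · refine lintegral_congr fun x => lintegral_congr fun y => ?_
    simp [MeasurableEquiv.piFinSuccAbove, Fin.insertNthEquiv]
  · exact (hf.comp hmp.measurable).aemeasurable

/-- Integrating out all but the last `k` variables of the density of a projection kernel. -/
lemma lintegral_kernelDet_lastIndex {κ : Λ → Λ → ℍ[ℝ]} {N : ℕ} (h : IsProjectionKernel μ κ N)
    {k n : ℕ} (hkn : k ≤ n) (hn : n ≤ N) {g : (Fin k → Λ) → ℝ≥0∞} (hg : Measurable g) :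
    ∫⁻ x, g (fun i => x (lastIndex hkn i)) * ENNReal.ofReal (kernelDet κ x)
        ∂(Measure.pi fun _ : Fin n => μ) =
      ((N - k).descFactorial (n - k) : ℕ) *
        ∫⁻ x, g x * ENNReal.ofReal (kernelDet κ x) ∂(Measure.pi fun _ : Fin k => μ) := by
  induction n, hkn using Nat.le_induction with
  | base => simp [lastIndex]
  | succ n hkn ih =>
    have hmeas : Measurable fun x : Fin (n + 1) → Λ =>
        g (fun i => x (lastIndex (hkn.trans n.le_succ) i)) * ENNReal.ofReal (kernelDet κ x) :=
      (hg.comp (measurable_pi_lambda _ fun i => measurable_pi_apply _)).mul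
        (measurable_kernelDet h.stronglyMeasurable _).ennreal_ofReal
    have hlast : ∀ (y : Λ) (x : Fin n → Λ), (fun i => (Fin.cons y x : Fin (n + 1) → Λ)
        (lastIndex (hkn.trans n.le_succ) i)) = fun i => x (lastIndex hkn i) := by
      intro y x
      funext i
      have : lastIndex (hkn.trans n.le_succ) i = (lastIndex hkn i).succ := by
        ext; simp [lastIndex]; omega
      rw [this, Fin.cons_succ]
    have hdet : ∀ x : Fin n → Λ, Measurable fun y =>
        ENNReal.ofReal (kernelDet κ (Fin.cons y x : Fin (n + 1) → Λ)) := fun x =>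
      ((measurable_kernelDet h.stronglyMeasurable (n + 1)).comp
        (measurable_pi_lambda _ fun i => by
          refine Fin.cases ?_ (fun j => ?_) i
          · simpa using measurable_id'
          · simp)).ennreal_ofReal
    rw [lintegral_pi_succ hmeas]
    simp only [hlast]
    have : ∀ x : Fin n → Λ, ∫⁻ y, g (fun i => x (lastIndex hkn i)) *
        ENNReal.ofReal (kernelDet κ (Fin.cons y x : Fin (n + 1) → Λ)) ∂μ =
        ((N - n : ℕ) : ℝ≥0∞) *
          (g (fun i => x (lastIndex hkn i)) * ENNReal.ofReal (kernelDet κ x)) := by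
      intro x
      rw [lintegral_const_mul _ (hdet x), lintegral_kernelDet_cons h (by omega)]
      ring
    simp only [this]
    rw [lintegral_const_mul, ih (by omega), ← mul_assoc, Nat.succ_sub hkn,
      Nat.descFactorial_succ]
    · congr 2
      rw [← Nat.cast_mul, show N - k - (n - k) = N - n by omega]
    · exact (hg.comp (measurable_pi_lambda _ fun i => measurable_pi_apply _)).mul
        (measurable_kernelDet h.stronglyMeasurable _).ennreal_ofReal

/-- Integrating out all variables but those with indices in the range of `f`. -/
lemma lintegral_kernelDet_embedding {κ : Λ → Λ → ℍ[ℝ]} {N : ℕ} (h : IsProjectionKernel μ κ N)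
    {k : ℕ} (f : Fin k ↪ Fin N) {g : (Fin k → Λ) → ℝ≥0∞} (hg : Measurable g) :
    ∫⁻ x, g (x ∘ f) * ENNReal.ofReal (kernelDet κ x) ∂(Measure.pi fun _ : Fin N => μ) =
      (Nat.factorial (N - k)) *
        ∫⁻ x, g x * ENNReal.ofReal (kernelDet κ x) ∂(Measure.pi fun _ : Fin k => μ) := by
  have hkN : k ≤ N := by simpa using Fintype.card_le_of_embedding f
  have hinj : Function.Injective (lastIndex hkN) := fun i j hij => by
    ext; simpa [lastIndex] using hij
  obtain ⟨σ, hσ⟩ : ∃ σ : Equiv.Perm (Fin N), ∀ i, σ (lastIndex hkN i) = f i := by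
    exact Equiv.Perm.exists_extending_pair (lastIndex hkN) f hinj f.injective
  have hmp : MeasurePreserving (fun x : Fin N → Λ => x ∘ σ) (Measure.pi fun _ => μ)
      (Measure.pi fun _ => μ) := by
    have := measurePreserving_piCongrLeft (fun _ : Fin N => μ) σ.symm
    convert this using 1
    funext x i
    rw [MeasurableEquiv.coe_piCongrLeft]
    have h2 := Equiv.piCongrLeft_apply_apply (P := fun _ : Fin N => Λ) σ.symm x (σ i)
    rw [Equiv.symm_apply_apply] at h2
    exact h2.symm
  have hmeas : Measurable fun x : Fin N → Λ =>
      g (fun i => x (lastIndex hkN i)) * ENNReal.ofReal (kernelDet κ x) :=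
    (hg.comp (measurable_pi_lambda _ fun i => measurable_pi_apply _)).mul
      (measurable_kernelDet h.stronglyMeasurable _).ennreal_ofReal
  rw [← Nat.descFactorial_self, ← lintegral_kernelDet_lastIndex h hkN le_rfl hg,
    ← hmp.lintegral_comp hmeas]
  refine lintegral_congr fun x => ?_
  rw [kernelDet_comp_perm (h.posSemidef N x).1]
  congr 2
  funext i
  simp [hσ]

end ProjectionKernel

section FiniteField

variable {Λ : Type*} [TopologicalSpace Λ] [MeasurableSpace Λ]

omit [TopologicalSpace Λ] in
lemma sum_dirac_apply {N : ℕ} (x : Fin N → Λ) {A : Set Λ} (hA : MeasurableSet A) :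
    Measure.sum (fun i => Measure.dirac (x i)) A = ∑ i, A.indicator 1 (x i) := by
  rw [Measure.sum_apply _ hA, tsum_fintype]
  simp [Measure.dirac_apply' _ hA]

/-- The configuration of the points `x₁, …, x_N`. -/
def pointConfiguration {N : ℕ} (x : Fin N → Λ) : Configuration Λ :=
  ⟨Measure.sum fun i => Measure.dirac (x i), by
    refine ⟨⟨{i | i < N}, fun i => x ⟨i.1, i.2⟩, ?_⟩, fun C _ => ?_⟩
    · refine Measure.ext fun A hA => ?_
      rw [Measure.sum_apply _ hA, Measure.sum_apply _ hA]
      exact (Equiv.tsum_eq (Fin.equivSubtype (n := N)).symm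
        (fun i => Measure.dirac (x i) A)).symm
    · have : IsFiniteMeasure (Measure.sum fun i : Fin N => Measure.dirac (x i)) :=
        ⟨by rw [sum_dirac_apply x MeasurableSet.univ]; simp⟩
      exact measure_lt_top _ _⟩

lemma measurable_pointConfiguration (N : ℕ) :
    Measurable (pointConfiguration : (Fin N → Λ) → Configuration Λ) := by
  refine Measurable.subtype_mk (Measure.measurable_of_measurable_coe _ fun A hA => ?_)
  simp only [sum_dirac_apply _ hA]
  exact Finset.measurable_sum _ fun i _ =>
    (measurable_one.indicator hA).comp (measurable_pi_apply i)

lemma fallingFactorial_natCast (n k : ℕ) :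
    fallingFactorial (n : ℝ≥0∞) k = (n.descFactorial k : ℕ) := by
  simp [fallingFactorial, Nat.descFactorial_eq_prod_range]

lemma measurable_prod_fallingFactorial {m : ℕ} {A : Fin m → Set Λ} (κ : Fin m → ℕ)
    (hA : ∀ i, MeasurableSet (A i)) :
    Measurable fun ν : Configuration Λ => ∏ i, fallingFactorial (ν.1 (A i)) (κ i) := by
  refine Finset.measurable_prod _ fun i _ => ?_
  unfold fallingFactorial
  exact Finset.measurable_prod _ fun j _ =>
    ((Measure.measurable_coe (hA i)).comp measurable_subtype_coe).sub_const _

open Classical in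
lemma pointConfiguration_apply {N : ℕ} (x : Fin N → Λ) {A : Set Λ} (hA : MeasurableSet A) :
    (pointConfiguration x).1 A = (Fintype.card {l : Fin N // x l ∈ A} : ℕ) := by
  rw [pointConfiguration, sum_dirac_apply x hA, Fintype.card_subtype]
  simp [Set.indicator_apply]

omit [TopologicalSpace Λ] [MeasurableSpace Λ] in
lemma injective_of_blocks {N m : ℕ} {x : Fin N → Λ} {A : Fin m → Set Λ}
    {κ : Fin m → ℕ} (hdisj : Pairwise fun i j => Disjoint (A i) (A j))
    (g : ∀ i, Fin (κ i) ↪ {l : Fin N // x l ∈ A i}) :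
    Function.Injective fun p : (Σ i, Fin (κ i)) => (g p.1 p.2).1 := by
  rintro ⟨i, j⟩ ⟨i', j'⟩ hab
  have hi : i = i' := by
    by_contra hne
    refine Set.disjoint_left.1 (hdisj hne) (g i j).2 ?_
    have h2 := (g i' j').2
    rwa [← show (g i j).1 = (g i' j').1 from hab] at h2
  subst hi
  have : j = j' := (g i).injective (Subtype.ext hab)
  rw [this]

omit [TopologicalSpace Λ] [MeasurableSpace Λ] in
/-- Injective labellings of points lying in disjoint blocks split into the blocks. -/
def embeddingBlockEquiv {N m : ℕ} (x : Fin N → Λ) (A : Fin m → Set Λ)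
    (κ : Fin m → ℕ) (hdisj : Pairwise fun i j => Disjoint (A i) (A j)) :
    {f : Fin (∑ i, κ i) ↪ Fin N // x ∘ f ∈ blockProd A κ rfl} ≃
      ∀ i, Fin (κ i) ↪ {l : Fin N // x l ∈ A i} where
  toFun f i := ⟨fun j => ⟨f.1 (finSigmaFinEquiv ⟨i, j⟩), f.2 i j⟩, fun j j' h => by
    simpa using f.1.injective (congrArg Subtype.val h)⟩
  invFun g := ⟨finSigmaFinEquiv.symm.toEmbedding.trans ⟨_, injective_of_blocks hdisj g⟩,
    fun i j => by
      change x ((fun p : (Σ i, Fin (κ i)) => (g p.1 p.2).1)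
        (finSigmaFinEquiv.symm (finSigmaFinEquiv ⟨i, j⟩))) ∈ A i
      rw [Equiv.symm_apply_apply]
      exact (g i j).2⟩
  left_inv f := by
    refine Subtype.ext (Function.Embedding.ext fun a => ?_)
    exact congrArg f.1 (Equiv.apply_symm_apply finSigmaFinEquiv a)
  right_inv g := by
    funext i
    refine Function.Embedding.ext fun j => Subtype.ext ?_
    change (fun p : (Σ i, Fin (κ i)) => (g p.1 p.2).1)
        (finSigmaFinEquiv.symm (finSigmaFinEquiv ⟨i, j⟩)) = _
    rw [Equiv.symm_apply_apply]

open Classical in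
lemma prod_fallingFactorial_pointConfiguration {N m k : ℕ} (x : Fin N → Λ) (A : Fin m → Set Λ)
    (κ : Fin m → ℕ) (h : ∑ i, κ i = k) (hA : ∀ i, MeasurableSet (A i))
    (hdisj : Pairwise fun i j => Disjoint (A i) (A j)) :
    ∏ i, fallingFactorial ((pointConfiguration x).1 (A i)) (κ i) =
      ∑ f : Fin k ↪ Fin N, (blockProd A κ h).indicator 1 (x ∘ f) := by
  subst h
  simp only [pointConfiguration_apply x (hA _), fallingFactorial_natCast]
  have h1 := Fintype.card_congr (embeddingBlockEquiv x A κ hdisj)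
  rw [Fintype.card_pi] at h1
  simp only [Fintype.card_embedding_eq, Fintype.card_fin] at h1
  rw [← Nat.cast_prod, ← h1, Fintype.card_subtype]
  simp [Set.indicator_apply]

omit [TopologicalSpace Λ] in
lemma measurableSet_blockProd {m k : ℕ} {A : Fin m → Set Λ} {κ : Fin m → ℕ} (h : ∑ i, κ i = k)
    (hA : ∀ i, MeasurableSet (A i)) : MeasurableSet (blockProd A κ h) := by
  have : blockProd A κ h = ⋂ (i : Fin m) (j : Fin (κ i)),
      (fun x : Fin k → Λ => x (Fin.cast h (finSigmaFinEquiv ⟨i, j⟩))) ⁻¹' A i := by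
    ext x
    simp [blockProd]
  rw [this]
  exact MeasurableSet.iInter fun i => MeasurableSet.iInter fun j => measurable_pi_apply _ (hA i)

variable {μ : Measure Λ} [SigmaFinite μ]

omit [TopologicalSpace Λ] in
/-- By Hadamard's inequality, the determinants of a positive semidefinite trace class kernel are
integrable. -/
lemma integrable_kernelDet {κ : Λ → Λ → ℍ[ℝ]}
    (hm : StronglyMeasurable fun p : Λ × Λ => κ p.1 p.2)
    (hp : ∀ (n : ℕ) (x : Fin n → Λ), QuatPosSemidef (kernelMatrix κ x))
    (hd : Integrable (fun y => (κ y y).re) μ) (n : ℕ) :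
    Integrable (fun x : Fin n → Λ => kernelDet κ x) (Measure.pi fun _ => μ) := by
  refine Integrable.mono' (Integrable.fintype_prod fun _ : Fin n => hd)
    (measurable_kernelDet hm n).aestronglyMeasurable (Filter.Eventually.of_forall fun x => ?_)
  rw [Real.norm_eq_abs, abs_of_nonneg (show 0 ≤ kernelDet κ x from (hp n x).mooreDet_nonneg)]
  exact (hp n x).mooreDet_le_prod_diag

variable (μ) in
/-- The law of the point field with `N` points with density `Det_M(κ(x_i, x_j)) / N!`. -/
def projectionFieldLaw (κ : Λ → Λ → ℍ[ℝ]) (N : ℕ) : Measure (Configuration Λ) :=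
  ((Measure.pi fun _ : Fin N => μ).withDensity fun x =>
    (N.factorial : ℝ≥0∞)⁻¹ * ENNReal.ofReal (kernelDet κ x)).map pointConfiguration

omit [SigmaFinite μ] in
lemma lintegral_projectionFieldLaw {κ : Λ → Λ → ℍ[ℝ]} {N : ℕ} (hκ : IsProjectionKernel μ κ N)
    {F : Configuration Λ → ℝ≥0∞} (hF : Measurable F) :
    ∫⁻ ν, F ν ∂(projectionFieldLaw μ κ N) = (N.factorial : ℝ≥0∞)⁻¹ *
      ∫⁻ x, F (pointConfiguration x) * ENNReal.ofReal (kernelDet κ x)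
        ∂(Measure.pi fun _ : Fin N => μ) := by
  have hk := (measurable_kernelDet hκ.stronglyMeasurable N).ennreal_ofReal
  have hFp : Measurable fun x : Fin N → Λ => F (pointConfiguration x) :=
    hF.comp (measurable_pointConfiguration N)
  rw [projectionFieldLaw, lintegral_map hF (measurable_pointConfiguration N),
    lintegral_withDensity_eq_lintegral_mul _ (hk.const_mul _) hFp,
    ← lintegral_const_mul' _ _ (by simp [Nat.factorial_ne_zero])]
  refine lintegral_congr fun x => ?_
  simp only [Pi.mul_apply]
  ring

lemma moment_projectionFieldLaw {κ : Λ → Λ → ℍ[ℝ]} {N : ℕ} (hκ : IsProjectionKernel μ κ N)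
    {m k : ℕ} (A : Fin m → Set Λ) (n : Fin m → ℕ) (h : ∑ i, n i = k)
    (hA : ∀ i, MeasurableSet (A i)) (hdisj : Pairwise fun i j => Disjoint (A i) (A j)) :
    ∫⁻ ν, ∏ i, fallingFactorial (ν.1 (A i)) (n i) ∂(projectionFieldLaw μ κ N) =
      ∫⁻ x in blockProd A n h, ENNReal.ofReal (kernelDet κ x) ∂(Measure.pi fun _ => μ) := by
  have hB := measurableSet_blockProd h hA
  have hg : Measurable ((blockProd A n h).indicator (1 : (Fin k → Λ) → ℝ≥0∞)) :=
    measurable_one.indicator hB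
  rw [lintegral_projectionFieldLaw hκ (measurable_prod_fallingFactorial n hA)]
  simp only [prod_fallingFactorial_pointConfiguration _ A n h hA hdisj, Finset.sum_mul]
  rw [lintegral_finsetSum]
  swap
  · intro f _
    exact (hg.comp (measurable_pi_lambda _ fun i => measurable_pi_apply _)).mul
      (measurable_kernelDet hκ.stronglyMeasurable _).ennreal_ofReal
  simp only [lintegral_kernelDet_embedding hκ _ hg]
  rw [Finset.sum_const, Finset.card_univ, Fintype.card_embedding_eq, Fintype.card_fin,
    Fintype.card_fin, nsmul_eq_mul, ← lintegral_indicator hB]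
  have hind : ∀ x : Fin k → Λ, (blockProd A n h).indicator 1 x * ENNReal.ofReal (kernelDet κ x) =
      (blockProd A n h).indicator (fun x => ENNReal.ofReal (kernelDet κ x)) x := by
    intro x
    by_cases hx : x ∈ blockProd A n h <;> simp [hx]
  simp only [hind]
  rcases le_or_gt k N with hk | hk
  · rw [← mul_assoc, ← mul_assoc, mul_assoc (_⁻¹), ← Nat.cast_mul, mul_comm (N.descFactorial k),
      Nat.factorial_mul_descFactorial hk, ENNReal.inv_mul_cancel (by simp [Nat.factorial_ne_zero])
      (ENNReal.natCast_ne_top _), one_mul]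
  · simp [kernelDet_eq_zero hκ hk, Nat.descFactorial_eq_zero_iff_lt.2 hk]

lemma isProbabilityMeasure_projectionFieldLaw {κ : Λ → Λ → ℍ[ℝ]} {N : ℕ}
    (hκ : IsProjectionKernel μ κ N) : IsProbabilityMeasure (projectionFieldLaw μ κ N) := by
  constructor
  have h := moment_projectionFieldLaw hκ (m := 0) (k := 0) (fun i => i.elim0) (fun i => i.elim0)
    (by simp) (fun i => i.elim0) (fun i => i.elim0)
  rw [← lintegral_one]
  simp only [Finset.univ_eq_empty, Finset.prod_empty] at h
  rw [h]
  simp [blockProd, kernelDet, mooreDet_zero]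

lemma isCorrelationFunction_projectionFieldLaw {κ : Λ → Λ → ℍ[ℝ]} {N : ℕ}
    (hκ : IsProjectionKernel μ κ N) (k : ℕ) :
    IsCorrelationFunction μ (projectionFieldLaw μ κ N) k fun x => kernelDet κ x where
  nonneg x := kernelDet_nonneg hκ x
  locallyIntegrable := (integrable_kernelDet hκ.stronglyMeasurable hκ.posSemidef
    hκ.integrable_diag k).locallyIntegrable
  moment _ A n h hA hdisj := moment_projectionFieldLaw hκ A n h hA hdisj

end FiniteField

section WeightedKernel

variable {Λ ι : Type*}

/-- The kernel `∑_{k ∈ S} c_k u_k(x) u_k(y)^*`. -/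
def weightedKernel (S : Finset ι) (c : ι → ℝ) (u : ι → Λ → ℍ[ℝ]) (x y : Λ) : ℍ[ℝ] :=
  ∑ k ∈ S, c k • (u k x * star (u k y))

lemma kernelMatrix_weightedKernel (S : Finset ι) (c : ι → ℝ) (u : ι → Λ → ℍ[ℝ]) {n : ℕ}
    (x : Fin n → Λ) :
    kernelMatrix (weightedKernel S c u) x = ∑ k ∈ S, c k • outer fun i => u k (x i) := by
  ext i j : 1
  simp [kernelMatrix, weightedKernel, outer, Matrix.sum_apply]

lemma quatPosSemidef_sum_outer {n : ℕ} (S : Finset ι) {c : ι → ℝ} (hc : ∀ k, 0 ≤ c k)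
    (v : ι → Fin n → ℍ[ℝ]) : QuatPosSemidef (∑ k ∈ S, c k • outer (v k)) :=
  Finset.sum_induction _ QuatPosSemidef (fun _ _ => QuatPosSemidef.add) quatPosSemidef_zero
    fun k _ => (quatPosSemidef_outer _).smul (hc k)

lemma isHermitian_sum_outer {n : ℕ} (S : Finset ι) (c : ι → ℝ) (v : ι → Fin n → ℍ[ℝ]) :
    (∑ k ∈ S, c k • outer (v k)).IsHermitian :=
  Finset.sum_induction _ Matrix.IsHermitian (fun _ _ => Matrix.IsHermitian.add)
    Matrix.isHermitian_zero fun _ _ => isHermitian_smul (outer_isHermitian _) _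

lemma quatPosSemidef_weightedKernel (S : Finset ι) {c : ι → ℝ} (hc : ∀ k, 0 ≤ c k)
    (u : ι → Λ → ℍ[ℝ]) {n : ℕ} (x : Fin n → Λ) :
    QuatPosSemidef (kernelMatrix (weightedKernel S c u) x) := by
  rw [kernelMatrix_weightedKernel]
  exact quatPosSemidef_sum_outer S hc _

lemma kernelDet_weightedKernel_mono {c : ι → ℝ} (hc : ∀ k, 0 ≤ c k)
    (u : ι → Λ → ℍ[ℝ]) {n : ℕ} (x : Fin n → Λ) :
    Monotone fun S : Finset ι => kernelDet (weightedKernel S c u) x := by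
  classical
  intro S T hST
  obtain ⟨U, hU, rfl⟩ : ∃ U, Disjoint S U ∧ S ∪ U = T :=
    ⟨T \ S, Finset.disjoint_sdiff, Finset.union_sdiff_of_subset hST⟩
  clear hST
  induction U using Finset.induction_on with
  | empty => simp
  | insert a U ha ih =>
    rw [Finset.disjoint_insert_right] at hU
    refine (ih hU.2).trans ?_
    have : a ∉ S ∪ U := by simp [ha, hU.1]
    simp only [kernelDet, kernelMatrix_weightedKernel]
    rw [Finset.union_insert, Finset.sum_insert this, add_comm]
    exact (quatPosSemidef_sum_outer _ hc _).mooreDet_le_add_smul_outer _ (hc a)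

lemma tendsto_kernelDet_weightedKernel {c : ι → ℝ} (u : ι → Λ → ℍ[ℝ]) {n : ℕ} (x : Fin n → Λ)
    (hs : ∀ i j, Summable fun k => c k • (u k (x i) * star (u k (x j)))) :
    Filter.Tendsto (fun S : Finset ι => kernelDet (weightedKernel S c u) x) Filter.atTop
      (nhds (kernelDet (diagSeries c u) x)) := by
  have h1 : Filter.Tendsto (fun S : Finset ι => kernelMatrix (weightedKernel S c u) x)
      Filter.atTop (nhds (kernelMatrix (diagSeries c u) x)) :=
    tendsto_pi_nhds.2 fun i => tendsto_pi_nhds.2 fun j => (hs i j).hasSum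
  exact ((Quaternion.continuous_re.comp (continuous_mooreDet n)).tendsto _).comp h1

/-- The limit of the determinants of the finite subsystems. -/
def limitDet (c : ι → ℝ) (u : ι → Λ → ℍ[ℝ]) {n : ℕ} (x : Fin n → Λ) : ℝ≥0∞ :=
  ⨆ S : Finset ι, ENNReal.ofReal (kernelDet (weightedKernel S c u) x)

lemma limitDet_eq {c : ι → ℝ} (hc : ∀ k, 0 ≤ c k)
    (u : ι → Λ → ℍ[ℝ]) {n : ℕ} (x : Fin n → Λ)
    (hs : ∀ i j, Summable fun k => c k • (u k (x i) * star (u k (x j)))) :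
    limitDet c u x = ENNReal.ofReal (kernelDet (diagSeries c u) x) := by
  have hmono : Monotone fun S : Finset ι => ENNReal.ofReal (kernelDet (weightedKernel S c u) x) :=
    fun S T h => ENNReal.ofReal_le_ofReal (kernelDet_weightedKernel_mono hc u x h)
  exact tendsto_nhds_unique (tendsto_atTop_iSup hmono)
    (ENNReal.tendsto_ofReal (tendsto_kernelDet_weightedKernel u x hs))

lemma isHermitian_kernelMatrix_diagSeries (c : ι → ℝ) (u : ι → Λ → ℍ[ℝ]) {n : ℕ}
    (x : Fin n → Λ) : (kernelMatrix (diagSeries c u) x).IsHermitian := by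
  ext i j : 1
  simp only [Matrix.conjTranspose_apply, kernelMatrix, Matrix.of_apply, diagSeries, tsum_star]
  refine tsum_congr fun k => ?_
  rw [Quaternion.star_smul, star_mul, star_star]

lemma re_finsetSum {α : Type*} (S : Finset α) (f : α → ℍ[ℝ]) :
    (∑ k ∈ S, f k).re = ∑ k ∈ S, (f k).re := by
  induction S using Finset.cons_induction with
  | empty => simp
  | cons a S ha ih => simp only [Finset.sum_cons, Quaternion.re_add, ih]

variable [MeasurableSpace Λ] {μ : Measure Λ}

lemma stronglyMeasurable_weightedKernel {u : ι → Λ → ℍ[ℝ]} (hu : ∀ k, StronglyMeasurable (u k))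
    (S : Finset ι) (c : ι → ℝ) :
    StronglyMeasurable fun p : Λ × Λ => weightedKernel S c u p.1 p.2 := by
  unfold weightedKernel
  refine Finset.stronglyMeasurable_fun_sum S fun k _ => ?_
  exact (((hu k).comp_measurable measurable_fst).mul (continuous_star.comp_stronglyMeasurable
    ((hu k).comp_measurable measurable_snd))).const_smul (c k)

lemma isProjectionKernel_weightedKernel {u : ι → Λ → ℍ[ℝ]} (hu : ∀ k, StronglyMeasurable (u k))
    (hL : ∀ k, MemLp (u k) 2 μ) (h1 : ∀ k, ∫ x, star (u k x) * u k x ∂μ = 1)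
    (h0 : ∀ k l, k ≠ l → ∫ x, star (u k x) * u l x ∂μ = 0) (S : Finset ι) :
    IsProjectionKernel μ (weightedKernel S (fun _ => 1) u) S.card := by
  have hint : ∀ k l, Integrable (fun y => star (u k y) * u l y) μ := fun k l =>
    (hL k).star.integrable_mul (hL l)
  have hint2 : ∀ k l (a b : ℍ[ℝ]), Integrable (fun y => a * (star (u k y) * u l y) * b) μ :=
    fun k l a b => ((hint k l).const_mul a).mul_const b
  have hval2 : ∀ k l (a b : ℍ[ℝ]), ∫ y, a * (star (u k y) * u l y) * b ∂μ =
      a * (∫ y, star (u k y) * u l y ∂μ) * b := fun k l a b => by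
    rw [integral_mul_const_of_integrable ((hint k l).const_mul a),
      integral_const_mul_of_integrable (hint k l)]
  have hexp : ∀ x y z, weightedKernel S (fun _ => 1) u x y * weightedKernel S (fun _ => 1) u y z =
      ∑ k ∈ S, ∑ l ∈ S, u k x * (star (u k y) * u l y) * star (u l z) := by
    intro x y z
    simp [weightedKernel, Finset.sum_mul_sum, mul_assoc]
  have hdiag : ∀ y, (weightedKernel S (fun _ => 1) u y y).re =
      ∑ k ∈ S, (star (u k y) * u k y).re := by
    intro y
    simp only [weightedKernel, one_smul, Quaternion.self_mul_star, Quaternion.star_mul_self]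
    rw [re_finsetSum]
  refine ⟨stronglyMeasurable_weightedKernel hu S _,
    fun n x => quatPosSemidef_weightedKernel S (fun _ => zero_le_one) u x, fun x z => ?_,
    fun x z => ?_, ?_, ?_⟩
  · simp only [hexp]
    exact integrable_finsetSum _ fun k _ => integrable_finsetSum _ fun l _ => hint2 k l _ _
  · simp only [hexp]
    rw [integral_finsetSum _ fun k _ => integrable_finsetSum _ fun l _ => hint2 k l _ _]
    refine Finset.sum_congr rfl fun k hk => ?_
    rw [integral_finsetSum _ fun l _ => hint2 k l _ _, Finset.sum_eq_single k]
    · rw [hval2, h1, mul_one, one_smul]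
    · intro l _ hl
      rw [hval2, h0 k l hl.symm]
      simp
    · exact fun h => absurd hk h
  · simp only [hdiag]
    exact integrable_finsetSum _ fun k _ => integrable_re_quaternion (hint k k)
  · simp only [hdiag]
    rw [integral_finsetSum _ fun k _ => integrable_re_quaternion (hint k k)]
    rw [Finset.sum_congr rfl fun k _ => (integral_re_quaternion (hint k k)).symm.trans
      (by rw [h1, Quaternion.re_one])]
    simp

end WeightedKernel

section Bernoulli

variable {Λ Ω ι : Type*} [MeasurableSpace Ω] {ρ : Measure Ω} [IsProbabilityMeasure ρ]

/-- The expectation of the Moore-Dyson determinant over independent `0`-`1` valued weights. -/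
lemma integral_mooreDet_bernoulli {b : ι → Ω → ℝ} {lam : ι → ℝ} (hm : ∀ k, Measurable (b k))
    (hi : iIndepFun b ρ) (h01 : ∀ k ω, b k ω = 0 ∨ b k ω = 1) (hE : ∀ k, ∫ ω, b k ω ∂ρ = lam k)
    {n : ℕ} (v : ι → Fin n → ℍ[ℝ]) (S : Finset ι) {X : Matrix (Fin n) (Fin n) ℍ[ℝ]}
    (hX : X.IsHermitian) :
    Integrable (fun ω => (mooreDet (X + ∑ k ∈ S, b k ω • outer (v k))).re) ρ ∧
    ∫ ω, (mooreDet (X + ∑ k ∈ S, b k ω • outer (v k))).re ∂ρ =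
      (mooreDet (X + ∑ k ∈ S, lam k • outer (v k))).re := by
  classical
  have hint : ∀ k, Integrable (b k) ρ := fun k =>
    Integrable.of_bound (hm k).aestronglyMeasurable 1 (Filter.Eventually.of_forall fun ω => by
      rcases h01 k ω with h | h <;> simp [h])
  induction S using Finset.induction_on generalizing X with
  | empty => simp
  | insert a S ha ih =>
    have hXa := hX.add (outer_isHermitian (v a))
    obtain ⟨i1, e1⟩ := ih hX
    obtain ⟨i2, e2⟩ := ih hXa
    set f := fun ω => (mooreDet (X + ∑ k ∈ S, b k ω • outer (v k))).re with hf
    set g := fun ω => (mooreDet (X + outer (v a) + ∑ k ∈ S, b k ω • outer (v k))).re with hg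
    have haff : ∀ c : ι → ℝ, (mooreDet (X + ∑ k ∈ insert a S, c k • outer (v k))).re =
        (mooreDet (X + ∑ k ∈ S, c k • outer (v k))).re + c a *
          ((mooreDet (X + outer (v a) + ∑ k ∈ S, c k • outer (v k))).re -
            (mooreDet (X + ∑ k ∈ S, c k • outer (v k))).re) := by
      intro c
      rw [Finset.sum_insert ha, ← add_assoc, add_right_comm, mooreDet_add_smul_outer
        (hX.add (isHermitian_sum_outer S c v)), add_right_comm X (outer (v a))]
      simp
    have hind : IndepFun (b a) (fun ω => g ω - f ω) ρ := by
      have h1 := hi.indepFun_finset {a} S (by simpa using ha) hm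
      let G : (S → ℝ) → Matrix (Fin n) (Fin n) ℍ[ℝ] → ℝ := fun w Y =>
        (mooreDet (Y + ∑ k : S, w k • outer (v k))).re
      have hG : ∀ Y, Measurable fun w => G w Y := fun Y => by
        refine Continuous.measurable (Quaternion.continuous_re.comp
          ((continuous_mooreDet n).comp ?_))
        exact continuous_const.add (continuous_finsetSum _ fun k _ =>
          (continuous_apply k).smul continuous_const)
      have hφ : Measurable fun w : (({a} : Finset ι) → ℝ) => w ⟨a, Finset.mem_singleton_self a⟩ :=
        measurable_pi_apply _
      have h2 := h1.comp hφ ((hG (X + outer (v a))).sub (hG X))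
      have h3 : IndepFun (b a) (fun ω => G (fun k : S => b k ω) (X + outer (v a)) -
        G (fun k : S => b k ω) X) ρ := h2
      have hGb : ∀ Y ω, G (fun k : S => b k ω) Y =
          (mooreDet (Y + ∑ k ∈ S, b k ω • outer (v k))).re := fun Y ω => by
        simp only [G]
        rw [Finset.sum_coe_sort S fun k => b k ω • outer (v k)]
      simpa only [hGb] using h3
    simp only [haff]
    have i3 : Integrable (fun ω => b a ω * (g ω - f ω)) ρ :=
      hind.integrable_mul (hint a) (i2.sub i1)
    refine ⟨i1.add i3, ?_⟩
    rw [integral_add i1 i3, hind.integral_fun_mul_eq_mul_integral (hint a).1 (i2.sub i1).1,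
      integral_sub i2 i1, e1, e2, hE]

lemma lintegral_limitDet_bernoulli [Countable ι] {b : ι → Ω → ℝ} {lam : ι → ℝ}
    (hm : ∀ k, Measurable (b k)) (hi : iIndepFun b ρ) (h01 : ∀ k ω, b k ω = 0 ∨ b k ω = 1)
    (hE : ∀ k, ∫ ω, b k ω ∂ρ = lam k) (u : ι → Λ → ℍ[ℝ]) {n : ℕ} (x : Fin n → Λ) :
    ∫⁻ ω, limitDet (fun k => b k ω) u x ∂ρ = limitDet lam u x := by
  have hb : ∀ ω k, 0 ≤ b k ω := fun ω k => by rcases h01 k ω with h | h <;> simp [h]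
  have h := fun S => integral_mooreDet_bernoulli hm hi h01 hE (fun k i => u k (x i)) S
    (X := (0 : Matrix (Fin n) (Fin n) ℍ[ℝ])) Matrix.isHermitian_zero
  simp only [zero_add, ← kernelMatrix_weightedKernel] at h
  change ∀ S : Finset ι, Integrable (fun ω => kernelDet (weightedKernel S (fun k => b k ω) u) x) ρ ∧
    ∫ ω, kernelDet (weightedKernel S (fun k => b k ω) u) x ∂ρ =
      kernelDet (weightedKernel S lam u) x at h
  unfold limitDet
  rw [lintegral_iSup_directed (fun S => (h S).1.aemeasurable.ennreal_ofReal)]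
  · refine iSup_congr fun S => ?_
    rw [← ofReal_integral_eq_lintegral_ofReal (h S).1 (Filter.Eventually.of_forall fun ω =>
      (quatPosSemidef_weightedKernel S (hb ω) u x).mooreDet_nonneg)]
    exact congrArg _ (h S).2
  · refine Monotone.directed_le fun S T hST ω => ?_
    exact ENNReal.ofReal_le_ofReal (kernelDet_weightedKernel_mono (hb ω) u x hST)

end Bernoulli

section TraceSeries

variable {Λ ι : Type*}

/-- The series `∑ₖ cₖ |uₖ(x)|²` of nonnegative terms. -/
def traceSeries (c : ι → ℝ) (u : ι → Λ → ℍ[ℝ]) (x : Λ) : ℝ≥0∞ :=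
  ∑' k, ENNReal.ofReal (c k * Quaternion.normSq (u k x))

lemma re_weightedKernel_self (S : Finset ι) (c : ι → ℝ) (u : ι → Λ → ℍ[ℝ]) (x : Λ) :
    (weightedKernel S c u x x).re = ∑ k ∈ S, c k * Quaternion.normSq (u k x) := by
  rw [weightedKernel, re_finsetSum]
  refine Finset.sum_congr rfl fun k _ => ?_
  rw [Quaternion.self_mul_star, Quaternion.re_smul, Quaternion.re_coe, smul_eq_mul]

lemma re_weightedKernel_self_le {c : ι → ℝ} (hc : ∀ k, 0 ≤ c k) (u : ι → Λ → ℍ[ℝ]) {x : Λ}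
    (hx : traceSeries c u x ≠ ∞) (S : Finset ι) :
    (weightedKernel S c u x x).re ≤ (traceSeries c u x).toReal := by
  rw [re_weightedKernel_self, ← ENNReal.ofReal_le_iff_le_toReal hx, ENNReal.ofReal_sum_of_nonneg
    fun k _ => mul_nonneg (hc k) Quaternion.normSq_nonneg]
  exact ENNReal.sum_le_tsum S

lemma summable_of_traceSeries_ne_top {c : ι → ℝ} (hc : ∀ k, 0 ≤ c k) (u : ι → Λ → ℍ[ℝ])
    {x y : Λ} (hx : traceSeries c u x ≠ ∞) (hy : traceSeries c u y ≠ ∞) :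
    Summable fun k => ‖c k • (u k x * star (u k y))‖ := by
  have hs : ∀ {z : Λ}, traceSeries c u z ≠ ∞ → Summable fun k => c k * Quaternion.normSq (u k z) :=
    fun {z} hz => (ENNReal.summable_toReal hz).congr fun k =>
      ENNReal.toReal_ofReal (mul_nonneg (hc k) Quaternion.normSq_nonneg)
  refine Summable.of_nonneg_of_le (fun k => norm_nonneg _) (fun k => ?_) ((hs hx).add (hs hy))
  rw [norm_smul, norm_mul, Quaternion.norm_star, Real.norm_eq_abs, abs_of_nonneg (hc k),
    ← mul_add, Quaternion.normSq_eq_norm_mul_self, Quaternion.normSq_eq_norm_mul_self]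
  refine mul_le_mul_of_nonneg_left ?_ (hc k)
  nlinarith [sq_nonneg (‖u k x‖ - ‖u k y‖), sq_nonneg (‖u k x‖ + ‖u k y‖)]

lemma summable_of_finite_ne_zero {c : ι → ℝ} (hc : {k | c k ≠ 0}.Finite) (u : ι → Λ → ℍ[ℝ])
    (x y : Λ) : Summable fun k => c k • (u k x * star (u k y)) :=
  summable_of_hasFiniteSupport (hc.subset fun k hk h => hk (by simp [h]))

lemma kernelDet_diagSeries_nonneg {c : ι → ℝ} (hc : ∀ k, 0 ≤ c k)
    (u : ι → Λ → ℍ[ℝ]) {n : ℕ} (x : Fin n → Λ)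
    (hs : ∀ i j, Summable fun k => c k • (u k (x i) * star (u k (x j)))) :
    0 ≤ kernelDet (diagSeries c u) x :=
  ge_of_tendsto' (tendsto_kernelDet_weightedKernel u x hs) fun S =>
    (quatPosSemidef_weightedKernel S hc u x).mooreDet_nonneg

lemma limitDet_le {c : ι → ℝ} (hc : ∀ k, 0 ≤ c k) (u : ι → Λ → ℍ[ℝ]) {n : ℕ} {x : Fin n → Λ}
    (hx : ∀ i, traceSeries c u (x i) ≠ ∞) :
    limitDet c u x ≤ ENNReal.ofReal (∏ i, (traceSeries c u (x i)).toReal) := by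
  refine iSup_le fun S => ENNReal.ofReal_le_ofReal ?_
  have hp := quatPosSemidef_weightedKernel S hc u x
  exact hp.mooreDet_le_prod_diag.trans (Finset.prod_le_prod (fun i _ => hp.diag_nonneg i)
    fun i _ => re_weightedKernel_self_le hc u (hx i) S)

variable [MeasurableSpace Λ] {μ : Measure Λ}

lemma measurable_limitDet [Countable ι] {u : ι → Λ → ℍ[ℝ]} (hu : ∀ k, StronglyMeasurable (u k))
    (c : ι → ℝ) (n : ℕ) : Measurable fun x : Fin n → Λ => limitDet c u x :=
  Measurable.iSup fun S =>
    (measurable_kernelDet (stronglyMeasurable_weightedKernel hu S c) n).ennreal_ofReal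

lemma measurable_limitDet_prod [Countable ι] {Ω : Type*} [MeasurableSpace Ω] {b : ι → Ω → ℝ}
    (hb : ∀ k, Measurable (b k)) {u : ι → Λ → ℍ[ℝ]} (hu : ∀ k, StronglyMeasurable (u k)) (n : ℕ) :
    Measurable fun p : Ω × (Fin n → Λ) => limitDet (fun k => b k p.1) u p.2 := by
  refine Measurable.iSup fun S => (measurable_re_mooreDet fun i j => ?_).ennreal_ofReal
  simp only [kernelMatrix, Matrix.of_apply, weightedKernel]
  refine Finset.stronglyMeasurable_fun_sum S fun k _ => ?_
  exact ((hb k).comp measurable_fst).stronglyMeasurable.smul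
    (((hu k).comp_measurable ((measurable_pi_apply i).comp measurable_snd)).mul
      (continuous_star.comp_stronglyMeasurable
        ((hu k).comp_measurable ((measurable_pi_apply j).comp measurable_snd))))

omit [MeasurableSpace Λ] in
lemma measurable_limitDet_weights [Countable ι] {Ω : Type*} [MeasurableSpace Ω] {b : ι → Ω → ℝ}
    (hb : ∀ k, Measurable (b k)) (u : ι → Λ → ℍ[ℝ]) {n : ℕ} (x : Fin n → Λ) :
    Measurable fun ω => limitDet (fun k => b k ω) u x := by
  refine Measurable.iSup fun S => (measurable_re_mooreDet fun i j => ?_).ennreal_ofReal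
  simp only [kernelMatrix, Matrix.of_apply, weightedKernel]
  exact Finset.stronglyMeasurable_fun_sum S fun k _ => (hb k).stronglyMeasurable.smul_const _

lemma measurable_normSq_comp {v : Λ → ℍ[ℝ]} (hv : StronglyMeasurable v) :
    Measurable fun x => Quaternion.normSq (v x) :=
  (Quaternion.continuous_normSq.comp_stronglyMeasurable hv).measurable

lemma measurable_traceSeries [Countable ι] {u : ι → Λ → ℍ[ℝ]} (hu : ∀ k, StronglyMeasurable (u k))
    (c : ι → ℝ) : Measurable (traceSeries c u) :=
  Measurable.tsum fun k => ((measurable_normSq_comp (hu k)).const_mul _).ennreal_ofReal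

lemma lintegral_traceSeries [Countable ι] {c : ι → ℝ} (hc : ∀ k, 0 ≤ c k) {u : ι → Λ → ℍ[ℝ]}
    (hu : ∀ k, StronglyMeasurable (u k)) (hL : ∀ k, MemLp (u k) 2 μ)
    (h1 : ∀ k, ∫ x, star (u k x) * u k x ∂μ = 1) :
    ∫⁻ x, traceSeries c u x ∂μ = ∑' k, ENNReal.ofReal (c k) := by
  unfold traceSeries
  rw [lintegral_tsum fun k =>
    ((measurable_normSq_comp (hu k)).const_mul _).ennreal_ofReal.aemeasurable]
  refine tsum_congr fun k => ?_
  have hint : Integrable (fun x => star (u k x) * u k x) μ := (hL k).star.integrable_mul (hL k)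
  have hre := integrable_re_quaternion hint
  have h2 := integral_re_quaternion hint
  rw [h1] at h2
  simp only [Quaternion.star_mul_self, Quaternion.re_coe, Quaternion.re_one] at h2 hre
  simp only [ENNReal.ofReal_mul (hc k)]
  rw [lintegral_const_mul _ (measurable_normSq_comp (hu k)).ennreal_ofReal,
    ← ofReal_integral_eq_lintegral_ofReal hre
      (Filter.Eventually.of_forall fun _ => Quaternion.normSq_nonneg), ← h2, ENNReal.ofReal_one,
    mul_one]

end TraceSeries

section Indicators

variable {Ω ι : Type*} [MeasurableSpace Ω] {ρ : Measure Ω} {lam : ι → ℝ} {ξ : ι → Ω → ℝ}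

/-- The indicator of the event `ξ k = 1`. -/
def oneIndicator (ξ : ι → Ω → ℝ) (k : ι) (ω : Ω) : ℝ := Set.indicator {1} 1 (ξ k ω)

omit [MeasurableSpace Ω] in
lemma oneIndicator_eq (ξ : ι → Ω → ℝ) (k : ι) (ω : Ω) :
    oneIndicator ξ k ω = 0 ∨ oneIndicator ξ k ω = 1 := by
  by_cases h : ξ k ω = 1 <;> simp [oneIndicator, h]

omit [MeasurableSpace Ω] in
lemma oneIndicator_nonneg (ξ : ι → Ω → ℝ) (k : ι) (ω : Ω) : 0 ≤ oneIndicator ξ k ω := by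
  rcases oneIndicator_eq ξ k ω with h | h <;> simp [h]

omit [MeasurableSpace Ω] in
lemma oneIndicator_ne_zero {k : ι} {ω : Ω} : oneIndicator ξ k ω ≠ 0 ↔ ξ k ω = 1 := by
  by_cases h : ξ k ω = 1 <;> simp [oneIndicator, h]

lemma IsIndepBernoulli.measurable_oneIndicator (h : IsIndepBernoulli ρ lam ξ) (k : ι) :
    Measurable (oneIndicator ξ k) :=
  (measurable_one.indicator (measurableSet_singleton 1)).comp (h.measurable k)

lemma IsIndepBernoulli.iIndepFun_oneIndicator (h : IsIndepBernoulli ρ lam ξ) :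
    iIndepFun (oneIndicator ξ) ρ :=
  h.indep.comp (fun _ => Set.indicator {1} 1)
    fun _ => measurable_one.indicator (measurableSet_singleton 1)

lemma IsIndepBernoulli.integral_oneIndicator (h : IsIndepBernoulli ρ lam ξ)
    (hlam : ∀ k, 0 ≤ lam k) (k : ι) : ∫ ω, oneIndicator ξ k ω ∂ρ = lam k := by
  have hm : MeasurableSet {ω | ξ k ω = 1} := h.measurable k (measurableSet_singleton 1)
  have : oneIndicator ξ k = Set.indicator {ω | ξ k ω = 1} 1 := by
    funext ω
    simp [oneIndicator, Set.indicator_apply]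
  rw [this, integral_indicator_one hm, Measure.real, h.prob_one, ENNReal.toReal_ofReal (hlam k)]

lemma IsIndepBernoulli.ae_eq_oneIndicator [IsProbabilityMeasure ρ] [Countable ι]
    (h : IsIndepBernoulli ρ lam ξ) (hlam : ∀ k, lam k ∈ Set.Icc (0 : ℝ) 1) :
    ∀ᵐ ω ∂ρ, ∀ k, ξ k ω = oneIndicator ξ k ω := by
  refine ae_all_iff.2 fun k => ?_
  have h1 : MeasurableSet {ω | ξ k ω = 1} := h.measurable k (measurableSet_singleton 1)
  have h0 : MeasurableSet {ω | ξ k ω = 0} := h.measurable k (measurableSet_singleton 0)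
  have hu : ρ ({ω | ξ k ω = 1} ∪ {ω | ξ k ω = 0}) = 1 := by
    rw [measure_union _ h0, h.prob_one, h.prob_zero, ← ENNReal.ofReal_add (hlam k).1
      (by linarith [(hlam k).2])]
    · simp
    · refine Set.disjoint_left.2 fun ω h1 h0 => ?_
      simp only [Set.mem_ofPred_eq] at h1 h0
      rw [h1] at h0
      exact one_ne_zero h0
  have hae := (prob_compl_eq_zero_iff (h1.union h0)).2 hu
  filter_upwards [compl_mem_ae_iff.2 hae] with ω hω
  rw [compl_compl] at hω
  rcases hω with hω | hω <;> simp only [Set.mem_ofPred_eq] at hω <;> simp [oneIndicator, hω]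

lemma IsIndepBernoulli.ae_finite [Countable ι] (h : IsIndepBernoulli ρ lam ξ)
    (hlam : ∀ k, 0 ≤ lam k) (hsum : Summable lam) : ∀ᵐ ω ∂ρ, {k | ξ k ω = 1}.Finite := by
  refine ae_finite_setOfPred_mem (s := fun k => {ω | ξ k ω = 1}) ?_
  simp only [h.prob_one]
  rw [← ENNReal.ofReal_tsum_of_nonneg hlam hsum]
  exact ENNReal.ofReal_ne_top

end Indicators

section Complexify

lemma re_complexify (q : ℍ[ℝ]) : (complexify q).re = q.re := rfl

lemma imI_complexify (q : ℍ[ℝ]) : (complexify q).imI = q.imI := rfl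

lemma imJ_complexify (q : ℍ[ℝ]) : (complexify q).imJ = q.imJ := rfl

lemma imK_complexify (q : ℍ[ℝ]) : (complexify q).imK = q.imK := rfl

/-- The inclusion of the real quaternions into the complexified quaternions as a ring
homomorphism. -/
def complexifyHom : ℍ[ℝ] →+* ℍ[ℂ] where
  toFun := complexify
  map_zero' := by ext <;> simp [re_complexify, imI_complexify, imJ_complexify, imK_complexify]
  map_one' := by ext <;> simp [re_complexify, imI_complexify, imJ_complexify, imK_complexify]
  map_add' p q := by ext <;> simp [re_complexify, imI_complexify, imJ_complexify, imK_complexify]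
  map_mul' p q := by ext <;> simp [re_complexify, imI_complexify, imJ_complexify, imK_complexify]

lemma star_complexify (q : ℍ[ℝ]) : star (complexify q) = complexify (star q) := by
  ext <;> simp [re_complexify, imI_complexify, imJ_complexify, imK_complexify]

lemma complexify_coe_injective {r s : ℝ}
    (h : complexify (r : ℍ[ℝ]) = complexify (s : ℍ[ℝ])) : r = s := by
  have := congrArg (fun q : ℍ[ℂ] => q.re) h
  simpa [complexify] using this

variable {Λ ι : Type*}

lemma mooreDet_diagSeries_eq_coe (c : ι → ℝ) (u : ι → Λ → ℍ[ℝ]) {n : ℕ} (x : Fin n → Λ) :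
    mooreDet (kernelMatrix (diagSeries c u) x) = (kernelDet (diagSeries c u) x : ℝ) :=
  mooreDet_eq_coe_re (isHermitian_kernelMatrix_diagSeries c u x)

lemma mooreDet_complexify_diagSeries (c : ι → ℝ) (u : ι → Λ → ℍ[ℝ]) {n : ℕ} (x : Fin n → Λ) :
    mooreDet (Matrix.of fun i j => complexify (diagSeries c u (x i) (x j))) =
      complexify ((kernelDet (diagSeries c u) x : ℝ) : ℍ[ℝ]) := by
  rw [← mooreDet_diagSeries_eq_coe]
  exact (map_mooreDet complexifyHom _).symm

lemma isSelfDualKernel_complexify_diagSeries (c : ι → ℝ) (u : ι → Λ → ℍ[ℝ]) :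
    IsSelfDualKernel fun x y => complexify (diagSeries c u x y) := by
  intro x y
  rw [star_complexify]
  have := (isHermitian_kernelMatrix_diagSeries c u ![x, y]).apply 1 0
  exact congrArg _ this.symm

end Complexify

section OrthonormalSystem

variable {Λ ι : Type*} [MeasurableSpace Λ]

/-- Orthonormal systems of strongly measurable quaternion functions. -/
structure IsOrthonormalSystem (μ : Measure Λ) (u : ι → Λ → ℍ[ℝ]) : Prop where
  stronglyMeasurable : ∀ k, StronglyMeasurable (u k)
  memLp : ∀ k, MemLp (u k) 2 μ
  normalized : ∀ k, ∫ x, star (u k x) * u k x ∂μ = 1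
  orthogonal : ∀ k l, k ≠ l → ∫ x, star (u k x) * u l x ∂μ = 0

variable {μ : Measure Λ}

lemma HasRealDiagonalForm.exists_isOrthonormalSystem [Countable ι] {K : Λ → Λ → ℍ[ℂ]}
    {lam : ι → ℝ} {u : ι → Λ → ℍ[ℝ]} (hK : HasRealDiagonalForm μ K lam u) :
    ∃ v : ι → Λ → ℍ[ℝ], IsOrthonormalSystem μ v ∧ ∀ᵐ x ∂μ, ∀ k, u k x = v k x := by
  have hae : ∀ᵐ x ∂μ, ∀ k, u k x = (hK.memLp k).1.mk (u k) x :=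
    ae_all_iff.2 fun k => (hK.memLp k).1.ae_eq_mk
  have hint : ∀ k l, ∫ x, star ((hK.memLp k).1.mk (u k) x) * (hK.memLp l).1.mk (u l) x ∂μ =
      ∫ x, star (u k x) * u l x ∂μ := fun k l => by
    refine integral_congr_ae ?_
    filter_upwards [hae] with x hx
    rw [hx k, hx l]
  exact ⟨fun k => (hK.memLp k).1.mk (u k), ⟨fun k => (hK.memLp k).1.stronglyMeasurable_mk,
    fun k => (memLp_congr_ae (hK.memLp k).1.ae_eq_mk).1 (hK.memLp k),
    fun k => (hint k k).trans (hK.normalized k),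
    fun k l h => (hint k l).trans (hK.orthogonal k l h)⟩, hae⟩

lemma ae_pi_of_ae [SigmaFinite μ] {p : Λ → Prop} (h : ∀ᵐ x ∂μ, p x) (m : ℕ) :
    ∀ᵐ x ∂(Measure.pi fun _ : Fin m => μ), ∀ i, p (x i) :=
  ae_all_iff.2 fun i => (Measure.tendsto_eval_ae_ae (μ := fun _ : Fin m => μ) (i := i)).eventually h

omit [MeasurableSpace Λ] in
lemma kernelMatrix_diagSeries_congr {c : ι → ℝ} {u v : ι → Λ → ℍ[ℝ]} {m : ℕ} {x : Fin m → Λ}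
    (h : ∀ i k, u k (x i) = v k (x i)) :
    kernelMatrix (diagSeries c u) x = kernelMatrix (diagSeries c v) x := by
  ext i j : 1
  simp only [kernelMatrix, Matrix.of_apply, diagSeries, h]

omit [MeasurableSpace Λ] in
lemma kernelDet_diagSeries_congr {c : ι → ℝ} {u v : ι → Λ → ℍ[ℝ]} {m : ℕ} {x : Fin m → Λ}
    (h : ∀ i k, u k (x i) = v k (x i)) :
    kernelDet (diagSeries c u) x = kernelDet (diagSeries c v) x :=
  congrArg (fun X => (mooreDet X).re) (kernelMatrix_diagSeries_congr h)

lemma IsOrthonormalSystem.ae_traceSeries_ne_top [Countable ι] {v : ι → Λ → ℍ[ℝ]}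
    (hv : IsOrthonormalSystem μ v) {lam : ι → ℝ} (hlam : ∀ k, 0 ≤ lam k) (hsum : Summable lam) :
    ∫⁻ x, traceSeries lam v x ∂μ ≠ ∞ ∧ ∀ᵐ x ∂μ, traceSeries lam v x ≠ ∞ := by
  have h : ∫⁻ x, traceSeries lam v x ∂μ ≠ ∞ := by
    rw [lintegral_traceSeries hlam hv.stronglyMeasurable hv.memLp hv.normalized,
      ← ENNReal.ofReal_tsum_of_nonneg hlam hsum]
    exact ENNReal.ofReal_ne_top
  refine ⟨h, ?_⟩
  filter_upwards [ae_lt_top (measurable_traceSeries hv.stronglyMeasurable lam) h] with x hx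
  exact hx.ne

lemma IsOrthonormalSystem.integrable_toReal_limitDet [Countable ι] [SigmaFinite μ]
    {v : ι → Λ → ℍ[ℝ]} (hv : IsOrthonormalSystem μ v) {lam : ι → ℝ} (hlam : ∀ k, 0 ≤ lam k)
    (hsum : Summable lam) (m : ℕ) :
    Integrable (fun x : Fin m → Λ => (limitDet lam v x).toReal) (Measure.pi fun _ => μ) := by
  obtain ⟨h1, h2⟩ := hv.ae_traceSeries_ne_top hlam hsum
  have hint : Integrable (fun x => (traceSeries lam v x).toReal) μ :=
    integrable_toReal_of_lintegral_ne_top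
      (measurable_traceSeries hv.stronglyMeasurable lam).aemeasurable h1
  refine Integrable.mono' (Integrable.fintype_prod fun _ : Fin m => hint)
    (measurable_limitDet hv.stronglyMeasurable lam m).ennreal_toReal.aestronglyMeasurable ?_
  filter_upwards [ae_pi_of_ae h2 m] with x hx
  rw [Real.norm_eq_abs, abs_of_nonneg ENNReal.toReal_nonneg]
  exact ENNReal.toReal_le_of_le_ofReal
    (Finset.prod_nonneg fun i _ => ENNReal.toReal_nonneg) (limitDet_le hlam v hx)

omit [MeasurableSpace Λ] in
lemma kernelDet_eq_toReal_limitDet {c : ι → ℝ} (hc : ∀ k, 0 ≤ c k) (u : ι → Λ → ℍ[ℝ]) {m : ℕ}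
    {x : Fin m → Λ} (hs : ∀ i j, Summable fun k => c k • (u k (x i) * star (u k (x j)))) :
    kernelDet (diagSeries c u) x = (limitDet c u x).toReal := by
  rw [limitDet_eq hc u x hs, ENNReal.toReal_ofReal (kernelDet_diagSeries_nonneg hc u x hs)]

lemma HasRealDiagonalForm.mooreDet_eq {K : Λ → Λ → ℍ[ℂ]}
    {lam : ι → ℝ} {u v : ι → Λ → ℍ[ℝ]} (hK : HasRealDiagonalForm μ K lam u)
    (hlam : ∀ k, 0 ≤ lam k) {m : ℕ} {x : Fin m → Λ} (hx : ∀ i k, u k (x i) = v k (x i))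
    (ht : ∀ i, traceSeries lam v (x i) ≠ ∞) :
    mooreDet (Matrix.of fun i j => K (x i) (x j)) =
      complexify (((limitDet lam v x).toReal : ℝ) : ℍ[ℝ]) := by
  have hs : ∀ i j, Summable fun k => ‖lam k • (v k (x i) * star (v k (x j)))‖ :=
    fun i j => summable_of_traceSeries_ne_top hlam v (ht i) (ht j)
  rw [← kernelDet_eq_toReal_limitDet hlam v fun i j => (hs i j).of_norm,
    ← mooreDet_complexify_diagSeries]
  congr 2
  funext i j
  rw [hK.eq_series _ _ (by simpa only [hx] using hs i j)]
  simp only [diagSeries, hx]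

end OrthonormalSystem

section Selection

variable {Ω ι : Type*} [MeasurableSpace Ω]

open Classical in
/-- The set of indices `k` with `ξ k = 1`, or the empty set if there are infinitely many. -/
def selectedIndices (ξ : ι → Ω → ℝ) (ω : Ω) : Finset ι :=
  if h : {k | ξ k ω = 1}.Finite then h.toFinset else ∅

omit [MeasurableSpace Ω] in
lemma mem_selectedIndices {ξ : ι → Ω → ℝ} {ω : Ω} (h : {k | ξ k ω = 1}.Finite) (k : ι) :
    k ∈ selectedIndices ξ ω ↔ ξ k ω = 1 := by
  rw [selectedIndices, dif_pos h, Set.Finite.mem_toFinset]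
  rfl

lemma measurable_selectedIndices [Countable ι] {ξ : ι → Ω → ℝ} (hξ : ∀ k, Measurable (ξ k)) :
    @Measurable _ _ _ ⊤ (selectedIndices ξ) := by
  let _ : MeasurableSpace (Finset ι) := ⊤
  have hE : ∀ s : Finset ι, MeasurableSet {ω | ∀ k, ξ k ω = 1 ↔ k ∈ s} := by
    intro s
    rw [Set.ofPred_forall]
    refine MeasurableSet.iInter fun k => ?_
    have h1 : MeasurableSet {ω | ξ k ω = 1} := hξ k (measurableSet_singleton 1)
    exact h1.iff (MeasurableSet.const _)
  have hfin : ∀ ω, {k | ξ k ω = 1}.Finite ↔ ∃ s : Finset ι, ∀ k, ξ k ω = 1 ↔ k ∈ s := by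
    intro ω
    constructor
    · exact fun h => ⟨h.toFinset, fun k => by rw [Set.Finite.mem_toFinset]; rfl⟩
    · rintro ⟨s, hs⟩
      exact s.finite_toSet.subset fun k hk => (hs k).1 hk
  have hF : MeasurableSet {ω | {k | ξ k ω = 1}.Finite} := by
    simp only [hfin]
    rw [Set.ofPred_exists]
    exact MeasurableSet.iUnion hE
  refine measurable_to_countable' fun s => ?_
  have hpre : selectedIndices ξ ⁻¹' {s} =
      ({ω | {k | ξ k ω = 1}.Finite} ∩ {ω | ∀ k, ξ k ω = 1 ↔ k ∈ s}) ∪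
        ({ω | {k | ξ k ω = 1}.Finite}ᶜ ∩ {_ω | s = ∅}) := by
    ext ω
    by_cases h : {k | ξ k ω = 1}.Finite
    · have : selectedIndices ξ ω = s ↔ ∀ k, ξ k ω = 1 ↔ k ∈ s := by
        rw [Finset.ext_iff]
        exact forall_congr' fun k => by rw [mem_selectedIndices h]
      simp [h, this]
    · simp [h, selectedIndices, eq_comm]
  rw [hpre]
  exact (hF.inter (hE s)).union (hF.compl.inter (MeasurableSet.const _))

omit [MeasurableSpace Ω] in
lemma diagSeries_eq_weightedKernel {Λ : Type*} {ξ : ι → Ω → ℝ} {ω : Ω}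
    (h : {k | ξ k ω = 1}.Finite) (u : ι → Λ → ℍ[ℝ]) :
    diagSeries (fun k => oneIndicator ξ k ω) u =
      weightedKernel (selectedIndices ξ ω) (fun _ => 1) u := by
  funext x y
  rw [diagSeries, weightedKernel, tsum_eq_sum (s := selectedIndices ξ ω)]
  · refine Finset.sum_congr rfl fun k hk => ?_
    rw [mem_selectedIndices h] at hk
    simp [oneIndicator, hk]
  · intro k hk
    rw [mem_selectedIndices h] at hk
    simp [oneIndicator, hk]

end Selection

section Mixture

variable {Λ Ω ι : Type*} [MeasurableSpace Λ] [MeasurableSpace Ω]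
  [Countable ι] {μ : Measure Λ} [SigmaFinite μ] {ρ : Measure Ω} [IsProbabilityMeasure ρ]
  {lam : ι → ℝ} {u v : ι → Λ → ℍ[ℝ]} {ξ : ι → Ω → ℝ}

omit [MeasurableSpace Λ] in
lemma IsIndepBernoulli.ae_randomKernel_eq (hξ : IsIndepBernoulli ρ lam ξ)
    (hlam : ∀ k, lam k ∈ Set.Icc (0 : ℝ) 1) (hsum : Summable lam) :
    ∀ᵐ ω ∂ρ, {k | ξ k ω = 1}.Finite ∧
      randomKernel ξ u ω = diagSeries (fun k => oneIndicator ξ k ω) u := by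
  filter_upwards [hξ.ae_eq_oneIndicator hlam, hξ.ae_finite (fun k => (hlam k).1) hsum]
    with ω h1 h2
  refine ⟨h2, ?_⟩
  funext x y
  simp only [randomKernel, ← h1]

omit [MeasurableSpace Λ] [MeasurableSpace Ω] [Countable ι] in
lemma kernelDet_oneIndicator_eq {ω : Ω} (h : {k | ξ k ω = 1}.Finite) {m : ℕ} (x : Fin m → Λ) :
    kernelDet (diagSeries (fun k => oneIndicator ξ k ω) v) x =
      (limitDet (fun k => oneIndicator ξ k ω) v x).toReal :=
  kernelDet_eq_toReal_limitDet (fun k => oneIndicator_nonneg ξ k ω) v fun _ _ =>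
    summable_of_finite_ne_zero (h.subset fun _ hk => oneIndicator_ne_zero.1 hk) v _ _

/-- Point fields with the kernels `K_ξ`, depending measurably on the randomness of `ξ`. -/
lemma exists_kernel_isPfaffianPointField [TopologicalSpace Λ] (hv : IsOrthonormalSystem μ v)
    (huv : ∀ᵐ x ∂μ, ∀ k, u k x = v k x) (hξ : IsIndepBernoulli ρ lam ξ)
    (hlam : ∀ k, lam k ∈ Set.Icc (0 : ℝ) 1) (hsum : Summable lam) :
    ∃ P : Kernel Ω (Configuration Λ), IsMarkovKernel P ∧
      ∀ᵐ ω ∂ρ, IsPfaffianPointField μ (P ω) fun x y => complexify (randomKernel ξ u ω x y) := by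
  have hproj := isProjectionKernel_weightedKernel hv.stronglyMeasurable hv.memLp hv.normalized
    hv.orthogonal
  let law : Finset ι → Measure (Configuration Λ) := fun s =>
    projectionFieldLaw μ (weightedKernel s (fun _ => 1) v) s.card
  have hprob : ∀ s, IsProbabilityMeasure (law s) := fun s =>
    isProbabilityMeasure_projectionFieldLaw (hproj s)
  let _ : MeasurableSpace (Finset ι) := ⊤
  let P : Kernel Ω (Configuration Λ) :=
    ⟨fun ω => law (selectedIndices ξ ω), (measurable_from_top (f := law)).comp
      (measurable_selectedIndices hξ.measurable)⟩
  have hP : ∀ ω, P ω = law (selectedIndices ξ ω) := fun ω => rfl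
  refine ⟨P, ⟨fun ω => hprob _⟩, ?_⟩
  filter_upwards [hξ.ae_randomKernel_eq (u := u) hlam hsum] with ω ⟨hfin, hω⟩
  rw [hP, hω]
  refine ⟨hprob _, isSelfDualKernel_complexify_diagSeries _ _, fun m _ =>
    ⟨_, isCorrelationFunction_projectionFieldLaw (hproj _) m, ?_⟩⟩
  filter_upwards [ae_pi_of_ae huv m] with x hx
  rw [mooreDet_complexify_diagSeries, kernelDet_diagSeries_congr hx,
    diagSeries_eq_weightedKernel hfin]

omit [MeasurableSpace Λ] [SigmaFinite μ] in
lemma integral_mooreDet_randomKernel (hξ : IsIndepBernoulli ρ lam ξ) (hlam : ∀ k, lam k ∈ Set.Icc (0 : ℝ) 1) (hsum : Summable lam)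
    {m : ℕ} {x : Fin m → Λ} (hx : ∀ i k, u k (x i) = v k (x i))
    (ht : ∀ i, traceSeries lam v (x i) ≠ ∞) :
    Integrable (fun ω => mooreDet (kernelMatrix (randomKernel ξ u ω) x)) ρ ∧
      ∫ ω, mooreDet (kernelMatrix (randomKernel ξ u ω) x) ∂ρ =
        ((limitDet lam v x).toReal : ℝ) := by
  have hlam0 : ∀ k, 0 ≤ lam k := fun k => (hlam k).1
  have hL := lintegral_limitDet_bernoulli hξ.measurable_oneIndicator hξ.iIndepFun_oneIndicator
    (oneIndicator_eq ξ) (hξ.integral_oneIndicator hlam0) v x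
  have htop : limitDet lam v x ≠ ∞ := ne_top_of_le_ne_top ENNReal.ofReal_ne_top
    (limitDet_le hlam0 v ht)
  have hm : Measurable fun ω => limitDet (fun k => oneIndicator ξ k ω) v x :=
    measurable_limitDet_weights hξ.measurable_oneIndicator v x
  have hint := integrable_toReal_of_lintegral_ne_top hm.aemeasurable (by rw [hL]; exact htop)
  have hfin : ∀ᵐ ω ∂ρ, limitDet (fun k => oneIndicator ξ k ω) v x < ∞ :=
    ae_lt_top hm (by rw [hL]; exact htop)
  have hae : (fun ω => mooreDet (kernelMatrix (randomKernel ξ u ω) x)) =ᵐ[ρ]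
      fun ω => (limitDet (fun k => oneIndicator ξ k ω) v x).toReal • (1 : ℍ[ℝ]) := by
    filter_upwards [hξ.ae_randomKernel_eq (u := u) hlam hsum] with ω ⟨hω1, hω2⟩
    rw [hω2, kernelMatrix_diagSeries_congr hx, mooreDet_diagSeries_eq_coe,
      kernelDet_oneIndicator_eq hω1, ← Quaternion.coe_mul_eq_smul, mul_one]
  refine ⟨(integrable_congr hae).2 (hint.smul_const 1), ?_⟩
  rw [integral_congr_ae hae, integral_smul_const, integral_toReal hm.aemeasurable hfin, hL,
    ← Quaternion.coe_mul_eq_smul, mul_one]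

/-- Every mix of Pfaffian point fields with the kernels `K_ξ` is Pfaffian with kernel `K`. -/
lemma IsPfaffianMixture.isPfaffianPointField [TopologicalSpace Λ] {K : Λ → Λ → ℍ[ℂ]}
    (hKsd : IsSelfDualKernel K) (hK : HasRealDiagonalForm μ K lam u)
    (hv : IsOrthonormalSystem μ v) (huv : ∀ᵐ x ∂μ, ∀ k, u k x = v k x)
    (hξ : IsIndepBernoulli ρ lam ξ) (hlam : ∀ k, lam k ∈ Set.Icc (0 : ℝ) 1) (hsum : Summable lam)
    {Q : Measure (Configuration Λ)}
    (hQ : IsPfaffianMixture μ ρ (fun ω x y => complexify (randomKernel ξ u ω x y)) Q) :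
    IsPfaffianPointField μ Q K := by
  obtain ⟨P, hP, hPf, rfl⟩ := hQ
  have hlam0 : ∀ k, 0 ≤ lam k := fun k => (hlam k).1
  obtain ⟨-, ht⟩ := hv.ae_traceSeries_ne_top hlam0 hsum
  refine ⟨inferInstance, hKsd, fun m hm =>
    ⟨fun x => (limitDet lam v x).toReal, ⟨fun x => ENNReal.toReal_nonneg,
      (hv.integrable_toReal_limitDet hlam0 hsum m).locallyIntegrable, ?_⟩, ?_⟩⟩
  · intro r A κ h hA hdisj
    have hF := measurable_prod_fallingFactorial κ hA
    rw [Measure.lintegral_bind P.measurable.aemeasurable hF.aemeasurable]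
    have hmeas := measurable_limitDet_prod hξ.measurable_oneIndicator hv.stronglyMeasurable m
    calc ∫⁻ ω, ∫⁻ ν, ∏ i, fallingFactorial (ν.1 (A i)) (κ i) ∂(P ω) ∂ρ
        = ∫⁻ ω, ∫⁻ x in blockProd A κ h, limitDet (fun k => oneIndicator ξ k ω) v x
            ∂(Measure.pi fun _ => μ) ∂ρ := by
          refine lintegral_congr_ae ?_
          filter_upwards [hPf, hξ.ae_randomKernel_eq (u := u) hlam hsum] with ω hω ⟨hω1, hω2⟩
          obtain ⟨R, hR, hRx⟩ := hω.correlation m hm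
          rw [hR.moment r A κ h hA hdisj]
          refine lintegral_congr_ae (ae_restrict_of_ae ?_)
          filter_upwards [hRx, ae_pi_of_ae huv m] with x hx1 hx2
          have hsummable : ∀ i j, Summable fun k =>
              oneIndicator ξ k ω • (v k (x i) * star (v k (x j))) := fun i j =>
            summable_of_finite_ne_zero (hω1.subset fun _ hk => oneIndicator_ne_zero.1 hk) v _ _
          rw [hω2, mooreDet_complexify_diagSeries] at hx1
          rw [complexify_coe_injective hx1, limitDet_eq
            (fun k => oneIndicator_nonneg ξ k ω) v x hsummable, kernelDet_diagSeries_congr hx2]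
      _ = ∫⁻ x in blockProd A κ h, ∫⁻ ω, limitDet (fun k => oneIndicator ξ k ω) v x ∂ρ
            ∂(Measure.pi fun _ => μ) := lintegral_lintegral_swap hmeas.aemeasurable
      _ = ∫⁻ x in blockProd A κ h, ENNReal.ofReal (limitDet lam v x).toReal
            ∂(Measure.pi fun _ => μ) := by
          refine lintegral_congr_ae (ae_restrict_of_ae ?_)
          filter_upwards [ae_pi_of_ae ht m] with x hx
          rw [lintegral_limitDet_bernoulli hξ.measurable_oneIndicator hξ.iIndepFun_oneIndicator
            (oneIndicator_eq ξ) (hξ.integral_oneIndicator hlam0) v x, ENNReal.ofReal_toReal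
            (ne_top_of_le_ne_top ENNReal.ofReal_ne_top (limitDet_le hlam0 v hx))]
  · filter_upwards [ae_pi_of_ae huv m, ae_pi_of_ae ht m] with x hx1 hx2
    exact (hK.mooreDet_eq hlam0 hx1 hx2).symm

end Mixture

end PfaffianField

end

theorem theorem3 {Λ Ω ι : Type*} [TopologicalSpace Λ] [MeasurableSpace Λ] [MeasurableSpace Ω]
    [Countable ι] (μ : Measure Λ) [SigmaFinite μ] (ρ : Measure Ω) [IsProbabilityMeasure ρ]
    (K : Λ → Λ → ℍ[ℂ]) (lam : ι → ℝ) (u : ι → Λ → ℍ[ℝ]) (ξ : ι → Ω → ℝ)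
    (hKsd : IsSelfDualKernel K) (hK : HasRealDiagonalForm μ K lam u)
    (hlam : ∀ k, lam k ∈ Set.Icc (0 : ℝ) 1) (hsum : Summable lam)
    (hξ : IsIndepBernoulli ρ lam ξ) :
    (∃ Q : Measure (Configuration Λ),
      IsPfaffianMixture μ ρ (fun ω x y => complexify (randomKernel ξ u ω x y)) Q) ∧
    (∀ Q : Measure (Configuration Λ),
      IsPfaffianMixture μ ρ (fun ω x y => complexify (randomKernel ξ u ω x y)) Q →
        IsPfaffianPointField μ Q K) ∧
    (∀ m : ℕ, ∀ᵐ x ∂(Measure.pi fun _ : Fin m => μ),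
      Integrable (fun ω => mooreDet (Matrix.of fun i j => randomKernel ξ u ω (x i) (x j))) ρ ∧
      complexify (∫ ω, mooreDet (Matrix.of fun i j => randomKernel ξ u ω (x i) (x j)) ∂ρ) =
        mooreDet (Matrix.of fun i j => K (x i) (x j))) := by
  obtain ⟨v, hv, huv⟩ := hK.exists_isOrthonormalSystem
  obtain ⟨-, ht⟩ := hv.ae_traceSeries_ne_top (fun k => (hlam k).1) hsum
  refine ⟨?_, fun Q hQ => hQ.isPfaffianPointField hKsd hK hv huv hξ hlam hsum, fun m => ?_⟩
  · obtain ⟨P, hP, hPf⟩ := exists_kernel_isPfaffianPointField hv huv hξ hlam hsum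
    exact ⟨ρ.bind P, P, hP, hPf, rfl⟩
  · filter_upwards [ae_pi_of_ae huv m, ae_pi_of_ae ht m] with x hx1 hx2
    obtain ⟨h1, h2⟩ := integral_mooreDet_randomKernel hξ hlam hsum hx1 hx2
    refine ⟨h1, ?_⟩
    rw [hK.mooreDet_eq (fun k => (hlam k).1) hx1 hx2, ← h2]
    rfl
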